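/- \textbf{Proposition (Stability).} Let $\Omega\subset\mathbb{R}^n$ be a bounded, open, convex set (its boundary is then automatically Lipschitz), let $T>0$ and $\alpha>0$, and let $\mathcal V$ be a real Banach space continuously embedded into $C^{1,\alpha}_0(\Omega,\mathbb{R}^n)$, the closure of $C^\infty_c(\Omega,\mathbb{R}^n)$ in the $C^{1,\alpha}$ norm. Let $f_0\in L^2(\Omega,\mathbb{R})$. For $v\in L^2([0,T],\mathcal V)$, a function $f\in C^0([0,T],L^2(\Omega,\mathbb{R}))$ is called a weak solution of the continuity equation \[ \partial_t f+\operatorname{div}_x(v f)=0 \ \text{ on } [0,T]\times\Omega,\qquad f(0,\cdot)=f_0, \] if for all $\eta\in C^\infty_c([0,T)\times\Omega)$ \[ \int_0^T\!\!\int_\Omega f(t,x)\Bigl(v(t,x)\cdot\nabla_x\eta(t,x)+\frac{\partial}{\partial t}\eta(t,x)\Bigr)\,dx\,dt+\int_\Omega f_0(x)\,\eta(0,x)\,dx=0 . \] Let $v_i\rightharpoonup v$ weakly in $L^2([0,T],\mathcal V)$, let $f_i$ be a weak solution of the continuity equation with velocity field $v_i$ and initial value $f_0$, and let $f$ be a weak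 solution with velocity field $v$ and initial value $f_0$. Then for every $t\in[0,T]$ there is a subsequence $(f_{i_k})_k$ such that $f_{i_k}(t,\cdot)\to f(t,\cdot)$ in $L^2(\Omega,\mathbb{R})$ as $k\to\infty$. -/

import Mathlib

open MeasureTheory Set Filter Topology
open scoped NNReal ENNReal ContDiff

/-- The `C^{1,α}` norm on `Ω` (possibly infinite) of a map `u : ℝⁿ → ℝⁿ`:
`sup_Ω |u| + sup_Ω ‖Du‖ + [Du]_{α,Ω}`. Only the values of `u` on the open set `Ω` enter. -/
noncomputable def c1HolderNorm {n : ℕ} (Ω : Set (EuclideanSpace ℝ (Fin n))) (α : ℝ≥0)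
    (u : EuclideanSpace ℝ (Fin n) → EuclideanSpace ℝ (Fin n)) : ℝ≥0∞ :=
  (⨆ x ∈ Ω, ‖u x‖ₑ) + (⨆ x ∈ Ω, ‖fderiv ℝ u x‖ₑ) + eHolderNorm α (Ω.domRestrict (fderiv ℝ u))

/-- `u ∈ C^{1,α}_0(Ω, ℝⁿ)`: `u` is of class `C^{1,α}` on the open set `Ω` and is a limit in the
`C^{1,α}` norm of maps in `C^∞_c(Ω, ℝⁿ)`. Maps on `Ω` are represented by their extension by zero
to `ℝⁿ`, so that equality of maps on `Ω` is equality. -/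
structure MemC1HolderZero {n : ℕ} (Ω : Set (EuclideanSpace ℝ (Fin n))) (α : ℝ≥0)
    (u : EuclideanSpace ℝ (Fin n) → EuclideanSpace ℝ (Fin n)) : Prop where
  eq_zero_of_notMem : ∀ x, x ∉ Ω → u x = 0
  contDiffOn : ContDiffOn ℝ 1 u Ω
  norm_lt_top : c1HolderNorm Ω α u < ⊤
  mem_closure : ∀ ε : ℝ≥0∞, 0 < ε →
    ∃ φ : EuclideanSpace ℝ (Fin n) → EuclideanSpace ℝ (Fin n),
      ContDiff ℝ ∞ φ ∧ HasCompactSupport φ ∧ tsupport φ ⊆ Ω ∧ c1HolderNorm Ω α (u - φ) < ε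

/-- `ι` is a continuous embedding (an injective bounded linear map) of the normed space `V` into
`C^{1,α}_0(Ω, ℝⁿ)` with the `C^{1,α}` norm. -/
structure IsC1HolderZeroEmbedding {n : ℕ} {V : Type*} [NormedAddCommGroup V] [NormedSpace ℝ V]
    (Ω : Set (EuclideanSpace ℝ (Fin n))) (α : ℝ≥0)
    (ι : V →ₗ[ℝ] (EuclideanSpace ℝ (Fin n) → EuclideanSpace ℝ (Fin n))) : Prop where
  injective : Function.Injective ι
  mem : ∀ w, MemC1HolderZero Ω α (ι w)
  bounded : ∃ C : ℝ≥0, ∀ w, c1HolderNorm Ω α (ι w) ≤ C * ‖w‖ₑ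

/-- Weak convergence of a sequence in a real normed space. -/
def WeaklyTendsto {F : Type*} [NormedAddCommGroup F] [NormedSpace ℝ F]
    (u : ℕ → F) (u' : F) : Prop :=
  ∀ l : StrongDual ℝ F, Tendsto (fun i => l (u i)) atTop (𝓝 (l u'))

/-- `η ∈ C^∞_c([0,T) × Ω)`: such functions are the restrictions to `[0,T) × Ω` of smooth functions
on `ℝ × ℝⁿ` with compact support inside `(-∞,T) × Ω`. They need not vanish at time `0`. -/
structure IsTestFunction {n : ℕ} (T : ℝ) (Ω : Set (EuclideanSpace ℝ (Fin n)))
    (η : ℝ × EuclideanSpace ℝ (Fin n) → ℝ) : Prop where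
  contDiff : ContDiff ℝ ∞ η
  hasCompactSupport : HasCompactSupport η
  tsupport_subset : tsupport η ⊆ Iio T ×ˢ Ω

/-- `f ∈ C⁰([0,T], L²(Ω))` is a weak solution of the continuity equation
`∂ₜ f + div (v f) = 0` on `[0,T] × Ω`, `f(0,·) = f₀`, with velocity field `v ∈ L²([0,T], V)`,
where elements of `V` are regarded as vector fields through `ι`. -/
structure IsWeakSolution {n : ℕ} {V : Type*} [NormedAddCommGroup V] [NormedSpace ℝ V]
    (T : ℝ) (Ω : Set (EuclideanSpace ℝ (Fin n)))
    (ι : V →ₗ[ℝ] (EuclideanSpace ℝ (Fin n) → EuclideanSpace ℝ (Fin n)))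
    (f₀ : Lp ℝ 2 (volume.restrict Ω))
    (v : Lp V 2 (volume.restrict (Icc (0 : ℝ) T)))
    (f : ℝ → Lp ℝ 2 (volume.restrict Ω)) : Prop where
  continuousOn : ContinuousOn f (Icc 0 T)
  weak_formulation : ∀ η : ℝ × EuclideanSpace ℝ (Fin n) → ℝ, IsTestFunction T Ω η →
    (∫ t in Icc (0 : ℝ) T, ∫ x in Ω,
        f t x * (inner ℝ (ι (v t) x) (gradient (fun y => η (t, y)) x)
          + deriv (fun s => η (s, x)) t))
      + ∫ x in Ω, f₀ x * η (0, x) = 0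

/-! Formally, `f(t)` is the push-forward of `f₀` under the flow of `v`. The flow itself is never
constructed: it is replaced by Euler schemes. Divide `[0,t]` into `N` intervals and compose the maps
`id + ι (∫ v)`, one for each interval. Such a scheme depends on `v` only through finitely many time
integrals, so for fixed `N` it is continuous for weak convergence of the velocities
(`tendsto_eulerMap`).

Weak convergence of the solutions. Along a weak solution, one Euler step changes the pairing with a
test function `η` by a small error, and the pulled-back function `η ∘ (id + φ)` is again a test
function with controlled constants. Telescoping shows that `∫ f(t) η` is the limit of `∫ f₀ η ∘
X_N`, where `X_N` is the scheme with `N` steps (`tendsto_integral_comp_eulerMap`); in particular a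
weak solution is determined by its data. Schemes with `N` and `N * M` steps differ by `O(N^(-1/2))`,
with a constant that depends only on the `L²` norm of the velocity, so this limit is uniform along a
weakly convergent, hence bounded, sequence. Letting `i → ∞` with `N` fixed and large gives `∫ f_i(t)
η → ∫ f(t) η`.

Strong convergence. Approximate `f₀` in `L²` by a smooth `g`. The push-forward of `g` under
(smoothed) Euler schemes has a density whose sup and Hölder bounds depend only on `g` and a bound on
the velocity, because the Jacobians and the inverse maps are controlled by the `C^{1,β}` norms.
Composition with the schemes is uniformly bounded on `L²`, so by duality every `f_i(t)` lies within
`ε` of one bounded set of Hölder functions (`exists_forall_near_isHolderBounded`). That set is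
relatively compact in `L²`. Compactness up to `ε`, together with the weak limit, gives strong
convergence, even of the whole sequence.

Smooth compactly supported approximations `φ` of the increments are used wherever derivatives are
needed: `id + φ` is then a bijection that maps `Ω` onto itself, and test functions stay test
functions. -/

/-! ### Approximation of the velocity fields by smooth fields with compact support -/

/-- Pointwise bounds contained in a bound on the `C^{1,α}` norm. -/
lemma bounds_of_c1HolderNorm_le {n : ℕ} {Ω : Set (EuclideanSpace ℝ (Fin n))} {α M : ℝ≥0}
    {u : EuclideanSpace ℝ (Fin n) → EuclideanSpace ℝ (Fin n)} (h : c1HolderNorm Ω α u ≤ M) :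
    (∀ x ∈ Ω, ‖u x‖ ≤ M) ∧ (∀ x ∈ Ω, ‖fderiv ℝ u x‖ ≤ M) ∧
      ∀ x ∈ Ω, ∀ y ∈ Ω, ‖fderiv ℝ u x - fderiv ℝ u y‖ ≤ M * ‖x - y‖ ^ (α : ℝ) := by
  have h1 : (⨆ x ∈ Ω, ‖u x‖ₑ) ≤ M := (le_self_add.trans le_self_add).trans h
  have h2 : (⨆ x ∈ Ω, ‖fderiv ℝ u x‖ₑ) ≤ M := (le_add_self.trans le_self_add).trans h
  have h3 : eHolderNorm α (Ω.domRestrict (fderiv ℝ u)) ≤ M := le_add_self.trans h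
  refine ⟨fun x hx => ?_, fun x hx => ?_, fun x hx y hy => ?_⟩
  · have := (le_iSup₂ (f := fun x (_ : x ∈ Ω) => ‖u x‖ₑ) x hx).trans h1
    exact_mod_cast (enorm_le_coe.1 this)
  · have := (le_iSup₂ (f := fun x (_ : x ∈ Ω) => ‖fderiv ℝ u x‖ₑ) x hx).trans h2
    exact_mod_cast (enorm_le_coe.1 this)
  · have hm : MemHolder α (Ω.domRestrict (fderiv ℝ u)) :=
      eHolderNorm_lt_top.1 (h3.trans_lt ENNReal.coe_lt_top)
    have hle : nnHolderNorm α (Ω.domRestrict (fderiv ℝ u)) ≤ M := by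
      have := coe_nnHolderNorm_le_eHolderNorm.trans h3
      exact_mod_cast this
    have := hm.holderWith.dist_le ⟨x, hx⟩ ⟨y, hy⟩
    rw [dist_eq_norm, Subtype.dist_eq, dist_eq_norm] at this
    exact this.trans (by gcongr)

/-- A smooth vector field with compact support in `Ω` whose `C^{1,β}` norm is controlled by `m`. -/
structure IsRegularField {n : ℕ} (Ω : Set (EuclideanSpace ℝ (Fin n))) (β m : ℝ)
    (φ : EuclideanSpace ℝ (Fin n) → EuclideanSpace ℝ (Fin n)) : Prop where
  contDiff : ContDiff ℝ ∞ φ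
  hasCompactSupport : HasCompactSupport φ
  tsupport_subset : tsupport φ ⊆ Ω
  norm_le : ∀ x, ‖φ x‖ ≤ m
  norm_fderiv_le : ∀ x, ‖fderiv ℝ φ x‖ ≤ m
  norm_fderiv_sub_le : ∀ x ∈ Ω, ∀ y ∈ Ω, ‖fderiv ℝ φ x - fderiv ℝ φ y‖ ≤ m * ‖x - y‖ ^ β

namespace IsRegularField

variable {n : ℕ} {Ω : Set (EuclideanSpace ℝ (Fin n))} {β m : ℝ}
  {φ : EuclideanSpace ℝ (Fin n) → EuclideanSpace ℝ (Fin n)}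

lemma nonneg (h : IsRegularField Ω β m φ) : 0 ≤ m := (norm_nonneg _).trans (h.norm_le 0)

lemma eq_zero (h : IsRegularField Ω β m φ) {x : EuclideanSpace ℝ (Fin n)} (hx : x ∉ Ω) :
    φ x = 0 := image_eq_zero_of_notMem_tsupport fun h' => hx (h.tsupport_subset h')

lemma differentiable (h : IsRegularField Ω β m φ) : Differentiable ℝ φ :=
  h.contDiff.differentiable (by simp)

lemma norm_map_sub_le (h : IsRegularField Ω β m φ) (x y : EuclideanSpace ℝ (Fin n)) :
    ‖φ x - φ y‖ ≤ m * ‖x - y‖ :=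
  convex_univ.norm_image_sub_le_of_norm_fderiv_le (fun z _ => h.differentiable z)
    (fun z _ => h.norm_fderiv_le z) (mem_univ y) (mem_univ x)

end IsRegularField

/-- On a bounded set a Hölder exponent may be lowered at the cost of a constant. An exponent at most
`1` is needed so that Hölder constants grow by a factor linear in `m` under perturbations of the
identity, while `α` may exceed `1`. -/
lemma rpow_le_mul_rpow_min {α D r : ℝ} (hr : 0 ≤ r) (hrD : r ≤ D) (hD : 1 ≤ D)
    (hα : 0 < α) : r ^ α ≤ D ^ α * r ^ (min α 1) := by
  rcases hr.eq_or_lt with rfl | hr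
  · rw [Real.zero_rpow hα.ne']; positivity
  · have h1 : r ^ α = r ^ (α - min α 1) * r ^ (min α 1) := by
      rw [← Real.rpow_add hr]; ring_nf
    rw [h1]
    gcongr
    calc r ^ (α - min α 1) ≤ D ^ (α - min α 1) :=
          Real.rpow_le_rpow hr.le hrD (sub_nonneg.2 (min_le_left _ _))
      _ ≤ D ^ α := Real.rpow_le_rpow_of_exponent_le hD (by
          have : 0 < min α 1 := lt_min hα one_pos
          linarith)

/-- Elements of a space embedded in `C^{1,α}_0` are approximated by regular fields. -/
lemma IsC1HolderZeroEmbedding.exists_approx {n : ℕ} {V : Type*} [NormedAddCommGroup V]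
    [NormedSpace ℝ V] {Ω : Set (EuclideanSpace ℝ (Fin n))} {α : ℝ≥0}
    {ι : V →ₗ[ℝ] (EuclideanSpace ℝ (Fin n) → EuclideanSpace ℝ (Fin n))}
    (hι : IsC1HolderZeroEmbedding Ω α ι) (hΩ : IsOpen Ω) (hb : Bornology.IsBounded Ω)
    (hα : 0 < α) :
    ∃ β : ℝ, 0 < β ∧ β ≤ 1 ∧ ∃ C : ℝ, 0 ≤ C ∧ ∀ w, ∀ ε > 0,
      ∃ φ, IsRegularField Ω β (C * ‖w‖ + ε) φ ∧ ∀ x, ‖ι w x - φ x‖ ≤ ε := by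
  obtain ⟨C, hC⟩ := hι.bounded
  obtain ⟨D, hD⟩ := Metric.isBounded_iff.1 hb
  set K : ℝ := (max D 1) ^ (α : ℝ) with hK
  have hK1 : 1 ≤ K := Real.one_le_rpow (le_max_right _ _) α.2
  have hα' : (0 : ℝ) < α := hα
  refine ⟨min α 1, lt_min hα' one_pos, min_le_right _ _, C * K, by positivity,
    fun w ε hε => ?_⟩
  -- Lowering the exponent multiplies the Hölder seminorm of the error by at most `K`, hence the
  -- tolerance `ε / K`.
  have hεK : 0 < ε / K := by positivity
  obtain ⟨φ, hφ, hφc, hφs, hlt⟩ := (hι.mem w).mem_closure (ENNReal.ofReal (ε / K)) (by simpa)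
  obtain ⟨a1, a2, a3⟩ := bounds_of_c1HolderNorm_le
    (M := C * ‖w‖₊) (by simpa [enorm_eq_nnnorm] using hC w)
  obtain ⟨b1, b2, b3⟩ := bounds_of_c1HolderNorm_le (M := (ε / K).toNNReal) hlt.le
  simp only [NNReal.coe_mul, coe_nnnorm, Real.coe_toNNReal _ hεK.le] at a1 a2 a3 b1 b2 b3
  have hφd : Differentiable ℝ φ := hφ.differentiable (by simp)
  have hd : ∀ x ∈ Ω, fderiv ℝ (ι w - φ) x = fderiv ℝ (ι w) x - fderiv ℝ φ x := fun x hx =>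
    fderiv_sub (((hι.mem w).contDiffOn.differentiableOn one_ne_zero).differentiableAt
      (hΩ.mem_nhds hx)) (hφd x)
  have hφ0 : ∀ x ∉ Ω, φ x = 0 := fun x hx =>
    image_eq_zero_of_notMem_tsupport fun h' => hx (hφs h')
  have hφ0' : ∀ x ∉ Ω, fderiv ℝ φ x = 0 := fun x hx =>
    image_eq_zero_of_notMem_tsupport fun h' => hx (hφs (tsupport_fderiv_subset ℝ h'))
  have e1 : C * ‖w‖ ≤ C * K * ‖w‖ := by
    rw [mul_right_comm]; exact le_mul_of_one_le_right (by positivity) hK1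
  have e2 : ε / K ≤ ε := div_le_self hε.le hK1
  have e0 : 0 ≤ C * K * ‖w‖ + ε := by positivity
  have e3 : (C * ‖w‖ + ε / K) * K = C * K * ‖w‖ + ε := by field_simp
  refine ⟨φ, ⟨hφ, hφc, hφs, fun x => ?_, fun x => ?_, fun x hx y hy => ?_⟩, fun x => ?_⟩
  · by_cases hx : x ∈ Ω
    · have := norm_sub_le (ι w x) (ι w x - φ x)
      rw [sub_sub_cancel] at this
      have h2 := b1 x hx
      rw [Pi.sub_apply] at h2
      linarith [a1 x hx]
    · simpa [hφ0 x hx] using e0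
  · by_cases hx : x ∈ Ω
    · have := norm_sub_le (fderiv ℝ (ι w) x) (fderiv ℝ (ι w) x - fderiv ℝ φ x)
      rw [sub_sub_cancel, ← hd x hx] at this
      linarith [a2 x hx, b2 x hx]
    · simpa [hφ0' x hx] using e0
  · have h1 : ‖x - y‖ ≤ max D 1 := by
      rw [← dist_eq_norm]; exact (hD hx hy).trans (le_max_left _ _)
    have h2 := rpow_le_mul_rpow_min (norm_nonneg (x - y)) h1 (le_max_right _ _) hα'
    have h3 : fderiv ℝ φ x - fderiv ℝ φ y = (fderiv ℝ (ι w) x - fderiv ℝ (ι w) y) -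
        (fderiv ℝ (ι w - φ) x - fderiv ℝ (ι w - φ) y) := by
      rw [hd x hx, hd y hy]; abel
    calc ‖fderiv ℝ φ x - fderiv ℝ φ y‖ ≤ C * ‖w‖ * ‖x - y‖ ^ (α : ℝ) +
          ε / K * ‖x - y‖ ^ (α : ℝ) := by
          rw [h3]; exact (norm_sub_le _ _).trans (add_le_add (a3 x hx y hy) (b3 x hx y hy))
      _ = (C * ‖w‖ + ε / K) * ‖x - y‖ ^ (α : ℝ) := by ring
      _ ≤ (C * ‖w‖ + ε / K) * (K * ‖x - y‖ ^ (min (α : ℝ) 1)) := by gcongr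
      _ = _ := by rw [← mul_assoc, e3]
  · by_cases hx : x ∈ Ω
    · exact (b1 x hx).trans e2
    · simp [hφ0 x hx, (hι.mem w).eq_zero_of_notMem x hx, hε.le]

/-- The bounds on a vector field which is a uniform limit of regular fields. -/
lemma bounds_of_approx {n : ℕ} {Ω : Set (EuclideanSpace ℝ (Fin n))} {β M : ℝ}
    {u : EuclideanSpace ℝ (Fin n) → EuclideanSpace ℝ (Fin n)}
    (h : ∀ ε > 0, ∃ φ, IsRegularField Ω β (M + ε) φ ∧ ∀ x, ‖u x - φ x‖ ≤ ε) :
    (∀ x, ‖u x‖ ≤ M) ∧ ∀ x y, ‖u x - u y‖ ≤ M * ‖x - y‖ := by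
  constructor
  · intro x
    refine le_of_forall_pos_le_add fun ε hε => ?_
    obtain ⟨φ, hφ, hφu⟩ := h (ε / 2) (by positivity)
    have := norm_add_le (u x - φ x) (φ x)
    rw [sub_add_cancel] at this
    linarith [hφ.norm_le x, hφu x]
  · intro x y
    have key : ∀ ε > 0, ‖u x - u y‖ ≤ M * ‖x - y‖ + ε * (2 + ‖x - y‖) := by
      intro ε hε
      obtain ⟨φ, hφ, hφu⟩ := h ε hε
      have e : u x - u y = (u x - φ x) - (u y - φ y) + (φ x - φ y) := by abel
      rw [e]
      have h1 := norm_add_le ((u x - φ x) - (u y - φ y)) (φ x - φ y)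
      have h2 := norm_sub_le (u x - φ x) (u y - φ y)
      have h3 := hφ.norm_map_sub_le x y
      linarith [hφu x, hφu y]
    refine le_of_forall_pos_le_add fun ε hε => ?_
    have h2 : 0 < 2 + ‖x - y‖ := by positivity
    have := key (ε / (2 + ‖x - y‖)) (by positivity)
    rwa [div_mul_cancel₀ _ h2.ne'] at this

/-! ### Jacobians near the identity -/

/-- By the Leibniz formula the determinant is a polynomial in the matrix entries. -/
lemma contDiff_continuousLinearMap_det {E : Type*} [NormedAddCommGroup E] [NormedSpace ℝ E]
    [FiniteDimensional ℝ E] : ContDiff ℝ 1 (fun A : E →L[ℝ] E => A.det) := by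
  let b := Module.finBasis ℝ E
  have h : (fun A : E →L[ℝ] E => A.det) = fun A =>
      ∑ σ : Equiv.Perm (Fin (Module.finrank ℝ E)), (Equiv.Perm.sign σ : ℤ) *
        ∏ i, b.repr (A (b i)) (σ i) := by
    ext A
    rw [ContinuousLinearMap.det, ← LinearMap.det_toMatrix b, Matrix.det_apply']
    simp [LinearMap.toMatrix_apply]
  rw [h]
  refine ContDiff.sum fun σ _ => contDiff_const.mul (contDiff_prod fun i _ => ?_)
  have : (fun A : E →L[ℝ] E => b.repr (A (b i)) (σ i)) =
      fun A => (LinearMap.toContinuousLinearMap (b.coord (σ i))) (A (b i)) := by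
    ext A; simp
  rw [this]
  fun_prop

/-- A constant which controls the Jacobian of a perturbation of the identity of size at most
`ρ`. -/
structure IsDetBound (E : Type*) [NormedAddCommGroup E] [NormedSpace ℝ E] (c ρ : ℝ) : Prop where
  one_le : 1 ≤ c
  pos : 0 < ρ
  mul_le : c * ρ ≤ 1 / 2
  abs_det_sub_le : ∀ A B : E →L[ℝ] E, ‖A‖ ≤ ρ → ‖B‖ ≤ ρ →
    |(1 + A).det - (1 + B).det| ≤ c * ‖A - B‖

/-- The determinant is Lipschitz near the identity. -/
lemma exists_det_one_add_lipschitz (E : Type*) [NormedAddCommGroup E] [NormedSpace ℝ E]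
    [FiniteDimensional ℝ E] :
    ∃ c ρ : ℝ, IsDetBound E c ρ := by
  have h : ContDiffAt ℝ 1 (fun A : E →L[ℝ] E => (1 + A).det) 0 :=
    (contDiff_continuousLinearMap_det.comp (contDiff_const.add contDiff_id)).contDiffAt
  obtain ⟨K, s, hs, hK⟩ := h.exists_lipschitzOnWith
  obtain ⟨ρ, hρ, hρs⟩ := Metric.mem_nhds_iff.1 hs
  have hc : (0 : ℝ) < max (K : ℝ) 1 := lt_of_lt_of_le one_pos (le_max_right _ _)
  -- The bound `ρ / 2` keeps the closed ball inside the neighbourhood where the Lipschitz estimate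
  -- holds; the bound `1 / (2 * c)` yields `c * ρ ≤ 1 / 2`, which later keeps Jacobians above `1 /
  -- 2`.
  refine ⟨max (K : ℝ) 1, min (ρ / 2) (1 / (2 * max (K : ℝ) 1)), ⟨le_max_right _ _, by positivity, ?_, ?_⟩⟩
  · calc (max K 1 : ℝ) * min (ρ / 2) (1 / (2 * max K 1))
        ≤ max K 1 * (1 / (2 * max K 1)) := 
          mul_le_mul_of_nonneg_left (min_le_right _ _) hc.le
      _ = 1 / 2 := by field_simp
  · intro A B hA hB
    have mem : ∀ A : E →L[ℝ] E, ‖A‖ ≤ min (ρ / 2) (1 / (2 * max K 1)) → A ∈ s := fun A hA =>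
      hρs (by
        rw [mem_ball_zero_iff]
        exact (hA.trans (min_le_left _ _)).trans_lt (by linarith))
    have := hK.dist_le_mul A (mem A hA) B (mem B hB)
    rw [Real.dist_eq, dist_eq_norm] at this
    exact this.trans (by gcongr; exact le_max_left _ _)

/-! ### Perturbations of the identity by regular fields -/

namespace IsRegularField

variable {n : ℕ} {Ω : Set (EuclideanSpace ℝ (Fin n))} {β m : ℝ}
  {φ : EuclideanSpace ℝ (Fin n) → EuclideanSpace ℝ (Fin n)}

/-- The inverse of `id + φ` has Lipschitz constant `1 / (1 - m)`, and `(1 + 2 * m) * (1 - m) ≥ 1`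
for `0 ≤ m ≤ 1 / 2`. -/
lemma norm_sub_le_of_add (h : IsRegularField Ω β m φ) (hm : m ≤ 1 / 2)
    (x y : EuclideanSpace ℝ (Fin n)) : ‖x - y‖ ≤ (1 + 2 * m) * ‖(x + φ x) - (y + φ y)‖ := by
  have h1 := h.norm_map_sub_le x y
  have h2 := norm_sub_le ((x + φ x) - (y + φ y)) (φ x - φ y)
  have e : ((x + φ x) - (y + φ y)) - (φ x - φ y) = x - y := by abel
  rw [e] at h2
  have h3 : (1 - m) * ‖x - y‖ ≤ ‖(x + φ x) - (y + φ y)‖ := by linarith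
  have hm0 := h.nonneg
  calc ‖x - y‖ ≤ ((1 + 2 * m) * (1 - m)) * ‖x - y‖ :=
        le_mul_of_one_le_left (norm_nonneg _) (by nlinarith)
    _ = (1 + 2 * m) * ((1 - m) * ‖x - y‖) := by ring
    _ ≤ _ := by gcongr

lemma norm_add_sub_le (h : IsRegularField Ω β m φ) (x y : EuclideanSpace ℝ (Fin n)) :
    ‖(x + φ x) - (y + φ y)‖ ≤ (1 + m) * ‖x - y‖ := by
  have h1 := h.norm_map_sub_le x y
  have e : (x + φ x) - (y + φ y) = (x - y) + (φ x - φ y) := by abel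
  rw [e]
  have h2 := norm_add_le (x - y) (φ x - φ y)
  linarith

lemma injective_add (h : IsRegularField Ω β m φ) (hm : m ≤ 1 / 2) :
    Function.Injective fun x => x + φ x := fun x y hxy => by
  have := h.norm_sub_le_of_add hm x y
  simp only at hxy
  rw [hxy, sub_self, norm_zero, mul_zero] at this
  exact sub_eq_zero.1 (norm_le_zero_iff.1 this)

/-- The map differs from the identity by a contraction. Dimension zero is separate, since the
identity then has norm `0`. -/
lemma surjective_add (h : IsRegularField Ω β m φ) (hm : m ≤ 1 / 2) :
    Function.Surjective fun x => x + φ x := by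
  have happ : ApproximatesLinearOn (fun x => x + φ x)
      ((ContinuousLinearEquiv.refl ℝ (EuclideanSpace ℝ (Fin n))) :
        EuclideanSpace ℝ (Fin n) →L[ℝ] EuclideanSpace ℝ (Fin n)) univ m.toNNReal := by
    intro x _ y _
    have e : x + φ x - (y + φ y) - (x - y) = φ x - φ y := by abel
    simpa [e, Real.coe_toNNReal _ h.nonneg] using h.norm_map_sub_le x y
  refine happ.surjective ?_
  rcases subsingleton_or_nontrivial (EuclideanSpace ℝ (Fin n)) with hE | hE
  · exact Or.inl hE
  · right
    have h1 : ‖(ContinuousLinearEquiv.symm (ContinuousLinearEquiv.refl ℝ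
        (EuclideanSpace ℝ (Fin n))) : EuclideanSpace ℝ (Fin n) →L[ℝ] EuclideanSpace ℝ (Fin n))‖₊
        = 1 := by
      ext; simp
    rw [h1, inv_one]
    exact (Real.toNNReal_lt_one.2 (by linarith))

/-- Points outside `Ω` are fixed. If a point of `Ω` left `Ω`, its image would be fixed as well, and
injectivity would force the point to equal its image. -/
lemma add_mem_iff (h : IsRegularField Ω β m φ) (hm : m ≤ 1 / 2) (x : EuclideanSpace ℝ (Fin n)) :
    x + φ x ∈ Ω ↔ x ∈ Ω := by
  constructor
  · intro hx
    by_contra hx'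
    rw [h.eq_zero hx', add_zero] at hx
    exact hx' hx
  · intro hx
    by_contra hx'
    have : (x + φ x) + φ (x + φ x) = x + φ x := by rw [h.eq_zero hx', add_zero]
    exact hx' ((h.injective_add hm this).symm ▸ hx)

lemma image_add (h : IsRegularField Ω β m φ) (hm : m ≤ 1 / 2) :
    (fun x => x + φ x) '' Ω = Ω := by
  ext y
  constructor
  · rintro ⟨x, hx, rfl⟩
    exact (h.add_mem_iff hm x).2 hx
  · intro hy
    obtain ⟨x, rfl⟩ := h.surjective_add hm y
    exact ⟨x, (h.add_mem_iff hm x).1 hy, rfl⟩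

end IsRegularField

/-! ### Hölder densities and their push-forward -/

/-- Functions on `Ω` bounded by `G` which are `β`-Hölder with constant `G`. -/
structure IsHolderBounded {n : ℕ} (Ω : Set (EuclideanSpace ℝ (Fin n))) (β G : ℝ)
    (u : EuclideanSpace ℝ (Fin n) → ℝ) : Prop where
  abs_le : ∀ x ∈ Ω, |u x| ≤ G
  abs_sub_le : ∀ x ∈ Ω, ∀ y ∈ Ω, |u x - u y| ≤ G * ‖x - y‖ ^ β

/-- A factor `1 + m` instead of `(1 + m) ^ β` is convenient because products of such factors are
bounded by the exponential of the sum of the `m`. -/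
lemma one_add_rpow_le {m β r : ℝ} (hm : 0 ≤ m) (hβ1 : β ≤ 1) (hr : 0 ≤ r) :
    ((1 + m) * r) ^ β ≤ (1 + m) * r ^ β := by
  rw [Real.mul_rpow (by linarith) hr]
  gcongr
  calc (1 + m) ^ β ≤ (1 + m) ^ (1 : ℝ) := Real.rpow_le_rpow_of_exponent_le (by linarith) hβ1
    _ = 1 + m := Real.rpow_one _

/-- The push-forward of a Hölder density under a perturbation of the identity. -/
lemma IsRegularField.exists_pushforward_density {n : ℕ} {Ω : Set (EuclideanSpace ℝ (Fin n))}
    {β m c ρ G : ℝ} {φ : EuclideanSpace ℝ (Fin n) → EuclideanSpace ℝ (Fin n)}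
    (h : IsRegularField Ω β m φ) (hΩ : MeasurableSet Ω) (hβ : 0 < β) (hβ1 : β ≤ 1)
    (hc : IsDetBound (EuclideanSpace ℝ (Fin n)) c ρ) (hm : m ≤ ρ)
    {u : EuclideanSpace ℝ (Fin n) → ℝ} (hu : IsHolderBounded Ω β G u) (hG : 0 ≤ G) :
    ∃ u', IsHolderBounded Ω β (G * (1 + 14 * c * m)) u' ∧
      ∀ χ : EuclideanSpace ℝ (Fin n) → ℝ,
        ∫ x in Ω, u' x * χ x = ∫ x in Ω, u x * χ (x + φ x) := by
  have hm0 := h.nonneg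
  have hc1 := hc.one_le
  have hcm : c * m ≤ 1 / 2 := (mul_le_mul_of_nonneg_left hm (by linarith)).trans hc.mul_le
  have hm2 : m ≤ 1 / 2 := le_trans (le_mul_of_one_le_left hm0 hc1) hcm
  set d : EuclideanSpace ℝ (Fin n) → ℝ := fun x => (1 + fderiv ℝ φ x).det with hd
  have hd1 : ∀ x, |d x - 1| ≤ c * m := fun x => by
    have := hc.abs_det_sub_le (fderiv ℝ φ x) 0 ((h.norm_fderiv_le x).trans hm)
      (by simpa using hc.pos.le)
    have hone : (1 : EuclideanSpace ℝ (Fin n) →L[ℝ] EuclideanSpace ℝ (Fin n)).det = 1 :=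
      LinearMap.det_id
    rw [add_zero, sub_zero, hone] at this
    exact this.trans (by gcongr; exact h.norm_fderiv_le x)
  have hd2 : ∀ x ∈ Ω, ∀ y ∈ Ω, |d x - d y| ≤ c * m * ‖x - y‖ ^ β := fun x hx y hy => by
    have := hc.abs_det_sub_le (fderiv ℝ φ x) (fderiv ℝ φ y) ((h.norm_fderiv_le x).trans hm)
      ((h.norm_fderiv_le y).trans hm)
    rw [mul_assoc]
    exact this.trans (by gcongr; exact h.norm_fderiv_sub_le x hx y hy)
  have hdpos : ∀ x, 1 / 2 ≤ d x := fun x => by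
    have := (abs_le.1 (hd1 x)).1; linarith
  have hdpos' : ∀ x, 0 < d x := fun x => by linarith [hdpos x]
  have hdinv : ∀ x, 1 / d x ≤ 1 + 2 * (c * m) := fun x => by
    rw [div_le_iff₀ (hdpos' x)]
    have h1 := (abs_le.1 (hd1 x)).1
    have h2 : 0 ≤ c * m := by positivity
    nlinarith
  obtain ⟨S, hS⟩ := (h.surjective_add hm2).hasRightInverse
  have hST : ∀ x, S (x + φ x) = x := fun x => h.injective_add hm2 (hS _)
  -- The density of the push-forward is `u / d` transported by the inverse map `S`, where `d` is the
  -- Jacobian.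
  refine ⟨fun y => u (S y) / d (S y), ⟨?_, ?_⟩, ?_⟩
  · intro y hy
    rw [← h.image_add hm2] at hy
    obtain ⟨x, hx, rfl⟩ := hy
    simp only [hST]
    rw [abs_div, abs_of_pos (hdpos' x), div_eq_mul_one_div]
    refine mul_le_mul (hu.abs_le x hx) ((hdinv x).trans ?_) (by
      have := hdpos' x; positivity) hG
    have h2 : 0 ≤ c * m := by positivity
    linarith
  · intro x' hx y' hy
    rw [← h.image_add hm2] at hx hy
    obtain ⟨x, hx, rfl⟩ := hx
    obtain ⟨y, hy, rfl⟩ := hy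
    simp only [hST]
    have e : u x / d x - u y / d y =
        (u x - u y) * (1 / d x) + u y * ((d y - d x) * (1 / d x) * (1 / d y)) := by
      have := (hdpos' x).ne'; have := (hdpos' y).ne'
      field_simp; ring
    set r := ‖x - y‖ ^ β with hr
    have hr0 : 0 ≤ r := by positivity
    have hix : 0 ≤ 1 / d x := by have := hdpos' x; positivity
    have hiy : 0 ≤ 1 / d y := by have := hdpos' y; positivity
    have hi2 : ∀ x, 1 / d x ≤ 2 := fun x => by
      rw [div_le_iff₀ (hdpos' x)]; linarith [hdpos x]
    have hcm0 : 0 ≤ c * m := by positivity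
    have b1 : |u x / d x - u y / d y| ≤ G * (1 + 6 * (c * m)) * r := by
      rw [e]
      calc _ ≤ |u x - u y| * (1 / d x) + |u y| * (|d y - d x| * (1 / d x) * (1 / d y)) := by
            refine (abs_add_le _ _).trans ?_
            simp only [abs_mul, abs_of_nonneg hix, abs_of_nonneg hiy, le_refl]
        _ ≤ (G * r) * (1 + 2 * (c * m)) + G * ((c * m * r) * 2 * 2) := by
            have h3 := hd2 y hy x hx
            rw [norm_sub_rev] at h3
            gcongr
            · exact hu.abs_sub_le x hx y hy
            · exact hdinv x
            · exact hu.abs_le y hy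
            · exact hi2 x
            · exact hi2 y
        _ = _ := by ring
    have b2 : r ≤ (1 + 2 * m) * ‖(x + φ x) - (y + φ y)‖ ^ β :=
      (Real.rpow_le_rpow (norm_nonneg _) (h.norm_sub_le_of_add hm2 x y) hβ.le).trans
        (one_add_rpow_le (by linarith) hβ1 (norm_nonneg _))
    calc _ ≤ G * (1 + 6 * (c * m)) * ((1 + 2 * m) * ‖(x + φ x) - (y + φ y)‖ ^ β) :=
          b1.trans (by gcongr)
      _ = G * ((1 + 6 * (c * m)) * (1 + 2 * m)) * ‖(x + φ x) - (y + φ y)‖ ^ β := by ring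
      -- The constant `14` is `6 + 2 + 6`: since `1 ≤ c` and `m ≤ 1 / 2`, the terms `2 * m` and `12
      -- * c * m * m` are at most `2 * c * m` and `6 * c * m`.
      _ ≤ _ := by
          gcongr
          nlinarith [mul_nonneg hcm0 hm0]
  · intro χ
    -- The change of variables formula requires no integrability, so `χ` is arbitrary; this makes
    -- the iteration over several steps immediate.
    have hder : ∀ x ∈ Ω, HasFDerivWithinAt (fun x => x + φ x) (1 + fderiv ℝ φ x) Ω x := fun x _ =>
      ((hasFDerivAt_id x).add (h.differentiable x).hasFDerivAt).hasFDerivWithinAt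
    have := integral_image_eq_integral_abs_det_fderiv_smul volume hΩ hder
      (h.injective_add hm2).injOn (fun y => u (S y) / d (S y) * χ y)
    rw [h.image_add hm2] at this
    rw [this]
    refine setIntegral_congr_fun hΩ fun x _ => ?_
    simp only [hST, smul_eq_mul]
    have h1 := hdpos' x
    rw [abs_of_pos h1]
    change d x * _ = _
    field_simp

/-! ### Euler polygons -/

/-- The composition `(id + a (N-1)) ∘ ⋯ ∘ (id + a 0)`. -/
def eulerMap {E : Type*} [Add E] (a : ℕ → E → E) : ℕ → E → E
  | 0, x => x
  | N + 1, x => eulerMap a N x + a N (eulerMap a N x)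

lemma prod_one_add_le_exp_sum {m : ℕ → ℝ} {N : ℕ} (hm : ∀ l < N, 0 ≤ m l) :
    ∏ l ∈ Finset.range N, (1 + m l) ≤ Real.exp (∑ l ∈ Finset.range N, m l) := by
  rw [Real.exp_sum]
  refine Finset.prod_le_prod (fun l hl => ?_) (fun l _ => ?_)
  · linarith [hm l (Finset.mem_range.1 hl)]
  · rw [add_comm]; exact Real.add_one_le_exp _

/-- Discrete Grönwall estimate: an Euler polygon against an arbitrary sequence. -/
lemma norm_eulerMap_sub_le {E : Type*} [NormedAddCommGroup E] {a : ℕ → E → E} {m e : ℕ → ℝ}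
    {y : ℕ → E} {N : ℕ} (hm : ∀ l < N, 0 ≤ m l)
    (ha : ∀ l < N, ∀ x z, ‖a l x - a l z‖ ≤ m l * ‖x - z‖)
    (he : ∀ l < N, ‖a l (y l) - (y (l + 1) - y l)‖ ≤ e l) :
    ‖eulerMap a N (y 0) - y N‖ ≤
      Real.exp (∑ l ∈ Finset.range N, m l) * ∑ l ∈ Finset.range N, e l := by
  -- The induction closes with the product of the factors `1 + m l`; the exponential replaces it
  -- only at the end.
  have key : ‖eulerMap a N (y 0) - y N‖ ≤
      (∏ l ∈ Finset.range N, (1 + m l)) * ∑ l ∈ Finset.range N, e l := by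
    induction N with
    | zero => simp [eulerMap]
    | succ N ih =>
      have ih' := ih (fun l hl => hm l (hl.trans (Nat.lt_succ_self N)))
        (fun l hl => ha l (hl.trans (Nat.lt_succ_self N)))
        (fun l hl => he l (hl.trans (Nat.lt_succ_self N)))
      have h1 := ha N (Nat.lt_succ_self N) (eulerMap a N (y 0)) (y N)
      have h2 := he N (Nat.lt_succ_self N)
      have hmN := hm N (Nat.lt_succ_self N)
      rw [Finset.prod_range_succ, Finset.sum_range_succ]
      set P := ∏ l ∈ Finset.range N, (1 + m l)
      set S := ∑ l ∈ Finset.range N, e l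
      have hP : 1 ≤ P := by
        rw [← Finset.prod_const_one (s := Finset.range N)]
        refine Finset.prod_le_prod (fun _ _ => zero_le_one) fun l hl => ?_
        linarith [hm l ((Finset.mem_range.1 hl).trans (Nat.lt_succ_self N))]
      have e1 : eulerMap a (N + 1) (y 0) - y (N + 1) = (eulerMap a N (y 0) - y N) +
          (a N (eulerMap a N (y 0)) - a N (y N)) + (a N (y N) - (y (N + 1) - y N)) := by
        simp only [eulerMap]; abel
      have heN : 0 ≤ e N := (norm_nonneg _).trans h2
      calc ‖eulerMap a (N + 1) (y 0) - y (N + 1)‖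
          ≤ ‖eulerMap a N (y 0) - y N‖ + m N * ‖eulerMap a N (y 0) - y N‖ + e N := by
            rw [e1]
            exact (norm_add₃_le).trans (by gcongr)
        _ = (1 + m N) * ‖eulerMap a N (y 0) - y N‖ + e N := by ring
        _ ≤ (1 + m N) * (P * S) + P * (1 + m N) * e N := by
            gcongr
            exact le_mul_of_one_le_left heN (by nlinarith)
        _ = P * (1 + m N) * (S + e N) := by ring
  refine key.trans (mul_le_mul_of_nonneg_right (prod_one_add_le_exp_sum hm) ?_)
  exact Finset.sum_nonneg fun l hl => (norm_nonneg _).trans (he l (Finset.mem_range.1 hl))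

/-- The push-forward of a Hölder density under a composition of perturbations of the identity. -/
lemma exists_pushforward_density_eulerMap {n : ℕ} {Ω : Set (EuclideanSpace ℝ (Fin n))}
    {β c ρ G : ℝ} {φ : ℕ → EuclideanSpace ℝ (Fin n) → EuclideanSpace ℝ (Fin n)} {m : ℕ → ℝ}
    {N : ℕ} (h : ∀ l < N, IsRegularField Ω β (m l) (φ l)) (hΩ : MeasurableSet Ω) (hβ : 0 < β)
    (hβ1 : β ≤ 1) (hc : IsDetBound (EuclideanSpace ℝ (Fin n)) c ρ) (hm : ∀ l < N, m l ≤ ρ)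
    {u : EuclideanSpace ℝ (Fin n) → ℝ} (hu : IsHolderBounded Ω β G u) (hG : 0 ≤ G) :
    ∃ u', IsHolderBounded Ω β (G * Real.exp (14 * c * ∑ l ∈ Finset.range N, m l)) u' ∧
      ∀ χ : EuclideanSpace ℝ (Fin n) → ℝ,
        ∫ x in Ω, u' x * χ x = ∫ x in Ω, u x * χ (eulerMap φ N x) := by
  induction N with
  | zero => exact ⟨u, by simpa using hu, fun χ => rfl⟩
  | succ N ih =>
    obtain ⟨u₁, hu₁, h₁⟩ := ih (fun l hl => h l (hl.trans (Nat.lt_succ_self N)))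
      (fun l hl => hm l (hl.trans (Nat.lt_succ_self N)))
    obtain ⟨u₂, hu₂, h₂⟩ := (h N (Nat.lt_succ_self N)).exists_pushforward_density hΩ hβ hβ1 hc
      (hm N (Nat.lt_succ_self N)) hu₁ (by positivity)
    have hle : G * Real.exp (14 * c * ∑ l ∈ Finset.range N, m l) * (1 + 14 * c * m N) ≤
        G * Real.exp (14 * c * ∑ l ∈ Finset.range (N + 1), m l) := by
      rw [Finset.sum_range_succ, mul_add (14 * c), Real.exp_add, mul_assoc]
      gcongr
      rw [add_comm]; exact Real.add_one_le_exp _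
    refine ⟨u₂, ⟨fun x hx => (hu₂.abs_le x hx).trans hle, fun x hx y hy =>
      (hu₂.abs_sub_le x hx y hy).trans (by gcongr)⟩, fun χ => ?_⟩
    -- The last step is the outermost map, so it is the first to be moved onto the test function.
    rw [h₂, h₁ (fun x => χ (x + φ N x))]
    rfl

/-! ### Test functions with Hölder gradient -/

/-- At distance at most `1` the Lipschitz bound is the stronger one, since `r ≤ r ^ β`; at larger
distance the sup bound suffices, since `1 ≤ r ^ β`. -/
lemma norm_sub_le_mul_rpow {E F : Type*} [NormedAddCommGroup E] [NormedAddCommGroup F]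
    {g : E → F} {A L β : ℝ} (hA : ∀ x, ‖g x‖ ≤ A) (hL : ∀ x y, ‖g x - g y‖ ≤ L * ‖x - y‖)
    (hL0 : 0 ≤ L) (hβ : 0 < β) (hβ1 : β ≤ 1) (x y : E) :
    ‖g x - g y‖ ≤ (2 * A + L) * ‖x - y‖ ^ β := by
  have hA0 : 0 ≤ A := (norm_nonneg _).trans (hA x)
  rcases le_total ‖x - y‖ 1 with h | h
  · have h1 : ‖x - y‖ ≤ ‖x - y‖ ^ β := Real.self_le_rpow_of_le_one (norm_nonneg _) h hβ1
    have h2 : 0 ≤ ‖x - y‖ ^ β := by positivity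
    nlinarith [hL x y]
  · have h1 : 1 ≤ ‖x - y‖ ^ β := Real.one_le_rpow h hβ.le
    have h2 := norm_sub_le (g x) (g y)
    nlinarith [hA x, hA y]

/-- Smooth functions with compact support in `Ω` whose gradient is bounded by `G` and `β`-Hölder
with constant `G`. -/
structure IsRegularTest {n : ℕ} (Ω : Set (EuclideanSpace ℝ (Fin n))) (β G : ℝ)
    (η : EuclideanSpace ℝ (Fin n) → ℝ) : Prop where
  contDiff : ContDiff ℝ ∞ η
  hasCompactSupport : HasCompactSupport η
  tsupport_subset : tsupport η ⊆ Ω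
  norm_fderiv_le : ∀ x, ‖fderiv ℝ η x‖ ≤ G
  norm_fderiv_sub_le : ∀ x ∈ Ω, ∀ y ∈ Ω, ‖fderiv ℝ η x - fderiv ℝ η y‖ ≤ G * ‖x - y‖ ^ β

lemma ContDiff.exists_lipschitz_of_hasCompactSupport {E F : Type*} [NormedAddCommGroup E]
    [NormedSpace ℝ E] [NormedAddCommGroup F] [NormedSpace ℝ F] {g : E → F}
    (hg : ContDiff ℝ 1 g) (hc : HasCompactSupport g) :
    ∃ A L : ℝ, 0 ≤ L ∧ (∀ x, ‖g x‖ ≤ A) ∧ ∀ x y, ‖g x - g y‖ ≤ L * ‖x - y‖ := by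
  obtain ⟨A, hA⟩ := hc.exists_bound_of_continuous hg.continuous
  obtain ⟨L, hL⟩ := (hc.fderiv ℝ).exists_bound_of_continuous (hg.continuous_fderiv (by simp))
  refine ⟨A, L, (norm_nonneg _).trans (hL 0), hA, fun x y => ?_⟩
  exact convex_univ.norm_image_sub_le_of_norm_fderiv_le
    (fun z _ => hg.differentiable (by simp) z) (fun z _ => hL z) (mem_univ y) (mem_univ x)

lemma exists_isRegularTest {n : ℕ} {Ω : Set (EuclideanSpace ℝ (Fin n))} {β : ℝ} (hβ : 0 < β)
    (hβ1 : β ≤ 1) {η : EuclideanSpace ℝ (Fin n) → ℝ} (hη : ContDiff ℝ ∞ η)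
    (hc : HasCompactSupport η) (hs : tsupport η ⊆ Ω) : ∃ G, IsRegularTest Ω β G η := by
  obtain ⟨A, L, hL0, hA, hL⟩ := ContDiff.exists_lipschitz_of_hasCompactSupport
    (g := fderiv ℝ η) (hη.fderiv_right (m := 1)
      (by rw [one_add_one_eq_two]; exact WithTop.coe_le_coe.2 le_top)) (hc.fderiv ℝ)
  have hA0 : 0 ≤ A := (norm_nonneg _).trans (hA 0)
  exact ⟨2 * A + L, hη, hc, hs, fun x => (hA x).trans (by linarith),
    fun x _ y _ => norm_sub_le_mul_rpow hA hL hL0 hβ hβ1 x y⟩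

lemma exists_isHolderBounded {n : ℕ} (Ω : Set (EuclideanSpace ℝ (Fin n))) {β : ℝ} (hβ : 0 < β)
    (hβ1 : β ≤ 1) {g : EuclideanSpace ℝ (Fin n) → ℝ} (hg : ContDiff ℝ ∞ g)
    (hc : HasCompactSupport g) : ∃ G, 0 ≤ G ∧ IsHolderBounded Ω β G g := by
  obtain ⟨A, L, hL0, hA, hL⟩ := ContDiff.exists_lipschitz_of_hasCompactSupport
    (hg.of_le (m := 1) (by simp)) hc
  have hA0 : 0 ≤ A := (norm_nonneg _).trans (hA 0)
  exact ⟨2 * A + L, by positivity, fun x _ => (hA x).trans (by linarith),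
    fun x _ y _ => norm_sub_le_mul_rpow hA hL hL0 hβ hβ1 x y⟩

namespace IsRegularTest

variable {n : ℕ} {Ω : Set (EuclideanSpace ℝ (Fin n))} {β m G : ℝ}
  {φ : EuclideanSpace ℝ (Fin n) → EuclideanSpace ℝ (Fin n)} {η : EuclideanSpace ℝ (Fin n) → ℝ}

lemma nonneg (h : IsRegularTest Ω β G η) : 0 ≤ G := (norm_nonneg _).trans (h.norm_fderiv_le 0)

lemma differentiable (h : IsRegularTest Ω β G η) : Differentiable ℝ η :=
  h.contDiff.differentiable (by simp)

lemma abs_sub_le (h : IsRegularTest Ω β G η) (x y : EuclideanSpace ℝ (Fin n)) :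
    |η x - η y| ≤ G * ‖x - y‖ :=
  convex_univ.norm_image_sub_le_of_norm_fderiv_le (fun z _ => h.differentiable z)
    (fun z _ => h.norm_fderiv_le z) (mem_univ y) (mem_univ x)

/-- This is the stability that allows the telescoping over Euler steps: after all pull-backs the
constant has grown by at most the exponential of `4 ∑ m`. The Hölder bound on `Ω` survives because
`id + φ` preserves `Ω`; the support stays in `Ω` because the composition agrees with `η` wherever
`φ` vanishes. -/
lemma comp_add (h : IsRegularTest Ω β G η) (hφ : IsRegularField Ω β m φ) (hm : m ≤ 1 / 2)
    (hβ : 0 < β) (hβ1 : β ≤ 1) :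
    IsRegularTest Ω β (G * (1 + 4 * m)) (fun x => η (x + φ x)) := by
  have hG := h.nonneg
  have hm0 := hφ.nonneg
  have hd : ∀ x, fderiv ℝ (fun x => η (x + φ x)) x =
      (fderiv ℝ η (x + φ x)).comp (ContinuousLinearMap.id ℝ _ + fderiv ℝ φ x) := fun x =>
    ((h.differentiable _).hasFDerivAt.comp x
      ((hasFDerivAt_id x).add (hφ.differentiable x).hasFDerivAt)).fderiv
  have hn : ∀ x, ‖ContinuousLinearMap.id ℝ _ + fderiv ℝ φ x‖ ≤ 1 + m := fun x =>
    (norm_add_le _ _).trans (add_le_add ContinuousLinearMap.norm_id_le (hφ.norm_fderiv_le x))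
  have hsub : Function.support (fun x => η (x + φ x)) ⊆ tsupport η ∪ tsupport φ := by
    intro x hx
    by_cases hx' : φ x = 0
    · left
      refine subset_tsupport _ ?_
      simpa [hx'] using hx
    · exact Or.inr (subset_tsupport _ hx')
  have hK : IsCompact (tsupport η ∪ tsupport φ) :=
    h.hasCompactSupport.isCompact.union hφ.hasCompactSupport.isCompact
  refine ⟨h.contDiff.comp (contDiff_id.add hφ.contDiff),
    HasCompactSupport.of_support_subset_isCompact hK hsub,
    (closure_minimal hsub hK.isClosed).trans (union_subset h.tsupport_subset hφ.tsupport_subset),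
    fun x => ?_, fun x hx y hy => ?_⟩
  · rw [hd]
    calc _ ≤ G * (1 + m) := (ContinuousLinearMap.opNorm_comp_le _ _).trans
          (mul_le_mul (h.norm_fderiv_le _) (hn x) (norm_nonneg _) hG)
      _ ≤ _ := by gcongr; linarith
  · rw [hd, hd]
    have e : (fderiv ℝ η (x + φ x)).comp (ContinuousLinearMap.id ℝ _ + fderiv ℝ φ x) -
        (fderiv ℝ η (y + φ y)).comp (ContinuousLinearMap.id ℝ _ + fderiv ℝ φ y) =
        (fderiv ℝ η (x + φ x) - fderiv ℝ η (y + φ y)).comp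
          (ContinuousLinearMap.id ℝ _ + fderiv ℝ φ x) +
        (fderiv ℝ η (y + φ y)).comp (fderiv ℝ φ x - fderiv ℝ φ y) := by
      ext z; simp; abel
    rw [e]
    set r := ‖x - y‖ ^ β with hr
    have hr0 : 0 ≤ r := by positivity
    have h1 : ‖fderiv ℝ η (x + φ x) - fderiv ℝ η (y + φ y)‖ ≤ G * ((1 + m) * r) := by
      refine (h.norm_fderiv_sub_le _ ((hφ.add_mem_iff hm x).2 hx) _
        ((hφ.add_mem_iff hm y).2 hy)).trans ?_
      gcongr
      exact (Real.rpow_le_rpow (norm_nonneg _) (hφ.norm_add_sub_le x y) hβ.le).trans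
        (one_add_rpow_le hm0 hβ1 (norm_nonneg _))
    calc _ ≤ G * ((1 + m) * r) * (1 + m) + G * (m * r) := by
          refine (norm_add_le _ _).trans (add_le_add ?_ ?_)
          · exact (ContinuousLinearMap.opNorm_comp_le _ _).trans
              (mul_le_mul h1 (hn x) (norm_nonneg _) (by positivity))
          · exact (ContinuousLinearMap.opNorm_comp_le _ _).trans
              (mul_le_mul (h.norm_fderiv_le _) (hφ.norm_fderiv_sub_le x hx y hy)
                (norm_nonneg _) hG)
      _ = G * ((1 + m) ^ 2 + m) * r := by ring
      _ ≤ G * (1 + 4 * m) * r := by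
          have : (1 + m) ^ 2 + m ≤ 1 + 4 * m := by nlinarith
          gcongr

/-- Mean value inequality on the segment from `x` to `x + φ x`. Convexity of `Ω` keeps the segment
where the gradient is Hölder. The error is superlinear in `m`, so its sum over the steps vanishes
when the largest `m` does and the sum of the `m` stays bounded. -/
lemma taylor_le (h : IsRegularTest Ω β G η) (hφ : IsRegularField Ω β m φ) (hm : m ≤ 1 / 2)
    (hβ : 0 < β) (hΩ : Convex ℝ Ω) (x : EuclideanSpace ℝ (Fin n)) :
    |η (x + φ x) - η x - fderiv ℝ η x (φ x)| ≤ G * (m ^ β * m) := by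
  have hG := h.nonneg
  have hm0 := hφ.nonneg
  by_cases hx : x ∈ Ω
  · have hy := (hφ.add_mem_iff hm x).2 hx
    have key := (convex_segment x (x + φ x)).norm_image_sub_le_of_norm_fderiv_le'
      (f := η) (φ := fderiv ℝ η x) (C := G * m ^ β) (x := x) (y := x + φ x)
      (fun z _ => h.differentiable z) (fun z hz => ?_)
      (left_mem_segment ℝ _ _) (right_mem_segment ℝ _ _)
    · rw [add_sub_cancel_left] at key
      calc _ ≤ G * m ^ β * ‖φ x‖ := key
        _ ≤ G * m ^ β * m := by gcongr; exact hφ.norm_le x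
        _ = _ := by ring
    · refine (h.norm_fderiv_sub_le z (hΩ.segment_subset hx hy hz) x hx).trans ?_
      gcongr
      have : ‖z - x‖ ≤ ‖φ x‖ := by
        obtain ⟨t, ht, rfl⟩ := (segment_eq_image' ℝ x (x + φ x)) ▸ hz
        simp only [add_sub_cancel_left, norm_smul, Real.norm_eq_abs, abs_of_nonneg ht.1]
        exact mul_le_of_le_one_left (norm_nonneg _) ht.2
      exact this.trans (hφ.norm_le x)
  · have h0 : φ x = 0 := hφ.eq_zero hx
    simp only [h0, add_zero, sub_self, map_zero, abs_zero]
    positivity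

end IsRegularTest

/-! ### From the weak formulation in time to an integral identity -/

/-- A smooth cutoff in time which decreases from `1` to `0` on `[t - 2 δ, t - δ]`. -/
noncomputable def timeCutoff (t δ s : ℝ) : ℝ := Real.smoothTransition ((t - s) / δ - 1)

namespace timeCutoff

variable {t δ : ℝ}

lemma contDiff : ContDiff ℝ ∞ (timeCutoff t δ) :=
  Real.smoothTransition.contDiff.comp (((contDiff_const.sub contDiff_id).div_const _).sub
    contDiff_const)

lemma antitone (hδ : 0 < δ) : Antitone (timeCutoff t δ) := fun a b hab =>
  Real.smoothTransition.monotone (by gcongr)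

lemma eq_zero (hδ : 0 < δ) {s : ℝ} (hs : t - δ ≤ s) : timeCutoff t δ s = 0 := by
  refine Real.smoothTransition.zero_of_nonpos ?_
  rw [sub_nonpos, div_le_one hδ]; linarith

lemma eq_one (hδ : 0 < δ) {s : ℝ} (hs : s ≤ t - 2 * δ) : timeCutoff t δ s = 1 := by
  refine Real.smoothTransition.one_of_one_le ?_
  rw [le_sub_iff_add_le, le_div_iff₀ hδ]; linarith

lemma deriv_nonpos (hδ : 0 < δ) (s : ℝ) : deriv (timeCutoff t δ) s ≤ 0 :=
  (antitone hδ).deriv_nonpos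

lemma deriv_eq_zero (hδ : 0 < δ) {s : ℝ} (hs : s ∉ Icc (t - 2 * δ) t) :
    deriv (timeCutoff t δ) s = 0 := by
  rw [mem_Icc, not_and_or, not_le, not_le] at hs
  rcases hs with hs | hs
  · have : timeCutoff t δ =ᶠ[𝓝 s] fun _ => 1 := by
      filter_upwards [Iio_mem_nhds hs] with r hr using eq_one hδ (le_of_lt hr)
    rw [this.deriv_eq]; simp
  · have : timeCutoff t δ =ᶠ[𝓝 s] fun _ => 0 := by
      filter_upwards [Ioi_mem_nhds hs] with r hr
      exact eq_zero hδ (by linarith [show t < r from hr])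
    rw [this.deriv_eq]; simp

lemma continuous_deriv : Continuous (deriv (timeCutoff t δ)) :=
  contDiff.continuous_deriv (by simp)

lemma integral_deriv (hδ : 0 < δ) {T : ℝ} (h0 : 2 * δ ≤ t) (hT : t ≤ T) :
    ∫ s in (0 : ℝ)..T, deriv (timeCutoff t δ) s = -1 := by
  rw [intervalIntegral.integral_deriv_eq_sub
    (fun x _ => contDiff.differentiable (by simp) x)
    (continuous_deriv.intervalIntegrable _ _), eq_zero hδ (by linarith), eq_one hδ (by linarith)]
  norm_num

/-- Integration against the derivative of the cutoff approximates evaluation at `t`. -/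
lemma abs_integral_deriv_mul_add_le (hδ : 0 < δ) {T ε : ℝ} {g : ℝ → ℝ} (h0 : 2 * δ ≤ t)
    (hT : t ≤ T) (hg : ContinuousOn g (Icc 0 T))
    (hε : ∀ s ∈ Icc (t - 2 * δ) t, |g s - g t| ≤ ε) :
    |(∫ s in (0 : ℝ)..T, deriv (timeCutoff t δ) s * g s) + g t| ≤ ε := by
  have hT0 : 0 ≤ T := by linarith
  have hi : IntervalIntegrable (fun s => deriv (timeCutoff t δ) s * g s) volume 0 T :=
    (continuous_deriv.continuousOn.mul hg).intervalIntegrable_of_Icc hT0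
  have e : (∫ s in (0 : ℝ)..T, deriv (timeCutoff t δ) s * g s) + g t =
      ∫ s in (0 : ℝ)..T, deriv (timeCutoff t δ) s * (g s - g t) := by
    simp only [mul_sub]
    have hi' : IntervalIntegrable (fun s => deriv (timeCutoff t δ) s * g t) volume 0 T :=
      (continuous_deriv.mul continuous_const).intervalIntegrable _ _
    rw [intervalIntegral.integral_sub hi hi', intervalIntegral.integral_mul_const, integral_deriv hδ h0 hT]
    ring
  rw [e]
  have hb : ∀ s ∈ Ioc 0 T, ‖deriv (timeCutoff t δ) s * (g s - g t)‖ ≤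
      -deriv (timeCutoff t δ) s * ε := fun s _ => by
    rw [Real.norm_eq_abs, abs_mul, abs_of_nonpos (deriv_nonpos hδ s)]
    by_cases hs : s ∈ Icc (t - 2 * δ) t
    · exact mul_le_mul_of_nonneg_left (hε s hs) (by linarith [deriv_nonpos (t := t) hδ s])
    · simp [deriv_eq_zero hδ hs]
  have hi2 : IntervalIntegrable (fun s => -deriv (timeCutoff t δ) s * ε) volume 0 T :=
    (continuous_deriv.neg.mul continuous_const).intervalIntegrable _ _
  have := intervalIntegral.norm_integral_le_of_norm_le hT0 (Eventually.of_forall hb) hi2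
  rw [intervalIntegral.integral_mul_const, intervalIntegral.integral_neg,
    integral_deriv hδ h0 hT] at this
  simpa using this

end timeCutoff

/-- A continuous function whose distributional derivative on `[0, T)` is integrable is the
integral of that derivative. -/
lemma eq_add_integral_of_weak_deriv {T c : ℝ} {g k : ℝ → ℝ} (hT : 0 < T)
    (hg : ContinuousOn g (Icc 0 T)) (hk : IntegrableOn k (Icc 0 T))
    (h : ∀ θ : ℝ → ℝ, ContDiff ℝ ∞ θ → HasCompactSupport θ → tsupport θ ⊆ Iio T →
      (∫ s in Icc 0 T, (θ s * k s + deriv θ s * g s)) + θ 0 * c = 0) :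
    ∀ t ∈ Icc 0 T, g t = c + ∫ s in (0 : ℝ)..t, k s := by
  have hkI : IntervalIntegrable k volume 0 T :=
    (intervalIntegrable_iff_integrableOn_Icc_of_le hT.le).2 hk
  have hpos : ∀ t ∈ Ioc 0 T, g t = c + ∫ s in (0 : ℝ)..t, k s := by
    intro t ht
    -- The shift by `3` ensures `2 * δ j ≤ t`, so that the cutoff equals `1` at time `0`.
    set δ : ℕ → ℝ := fun j => t / (j + 3) with hδ
    have hδpos : ∀ j, 0 < δ j := fun j => div_pos ht.1 (by positivity)
    have hδt : ∀ j, 2 * δ j ≤ t := fun j => by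
      simp only [hδ]
      rw [mul_div_assoc', div_le_iff₀ (by positivity)]
      nlinarith [ht.1, (Nat.cast_nonneg j : (0 : ℝ) ≤ j)]
    have hδ0 : Tendsto δ atTop (𝓝 0) := by
      refine Tendsto.div_atTop tendsto_const_nhds ?_
      exact tendsto_atTop_add_const_right _ _ tendsto_natCast_atTop_atTop
    have hid : ∀ j, (∫ s in (0 : ℝ)..T, timeCutoff t (δ j) s * k s) +
        (∫ s in (0 : ℝ)..T, deriv (timeCutoff t (δ j)) s * g s) + c = 0 := by
      intro j
      have hχ : ContDiff ℝ ∞ (timeCutoff t (δ j)) := timeCutoff.contDiff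
      -- The cutoff equals `1` at all early times. The extra factor vanishes before `-2` and is `1`
      -- after `-1`: it makes the support compact without any change near `[0, T]`.
      set θ : ℝ → ℝ := fun s => Real.smoothTransition (s + 2) * timeCutoff t (δ j) s with hθ
      have hsupp : Function.support θ ⊆ Icc (-2) (t - δ j) := by
        intro s hs
        simp only [hθ, Function.mem_support, mul_ne_zero_iff] at hs
        constructor
        · by_contra hlt
          exact hs.1 (Real.smoothTransition.zero_of_nonpos (by linarith))
        · by_contra hlt
          exact hs.2 (timeCutoff.eq_zero (hδpos j) (by linarith))
      have hts : tsupport θ ⊆ Icc (-2) (t - δ j) := closure_minimal hsupp isClosed_Icc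
      have := h θ ((Real.smoothTransition.contDiff.comp (contDiff_id.add contDiff_const)).mul hχ)
        (HasCompactSupport.of_support_subset_isCompact isCompact_Icc hsupp)
        (hts.trans fun s hs => by
          have := hs.2; have := hδpos j; have := ht.2; rw [mem_Iio]; linarith)
      have hθeq : ∀ s, -1 ≤ s → θ s = timeCutoff t (δ j) s := fun s hs => by
        simp only [hθ]
        rw [Real.smoothTransition.one_of_one_le (by linarith), one_mul]
      have hθd : ∀ s, 0 ≤ s → deriv θ s = deriv (timeCutoff t (δ j)) s := fun s hs => by
        refine Filter.EventuallyEq.deriv_eq ?_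
        filter_upwards [Ioi_mem_nhds (show (-1 : ℝ) < s by linarith)] with r hr
        exact hθeq r (le_of_lt hr)
      rw [hθeq 0 (by norm_num), timeCutoff.eq_one (hδpos j) (by linarith [hδt j]), one_mul] at this
      refine Eq.trans ?_ this
      rw [← intervalIntegral.integral_add, intervalIntegral.integral_of_le hT.le,
        ← integral_Icc_eq_integral_Ioc]
      · congr 1
        refine setIntegral_congr_fun measurableSet_Icc fun s hs => ?_
        simp only [hθeq s (by linarith [hs.1]), hθd s hs.1]
      · exact hkI.continuousOn_mul hχ.continuous.continuousOn
      · exact (timeCutoff.continuous_deriv.continuousOn.mul hg).intervalIntegrable_of_Icc hT.le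
    have lim1 : Tendsto (fun j => ∫ s in (0 : ℝ)..T, timeCutoff t (δ j) s * k s) atTop
        (𝓝 (∫ s in (0 : ℝ)..T, (Iio t).indicator k s)) := by
      refine intervalIntegral.tendsto_integral_filter_of_dominated_convergence (fun s => ‖k s‖)
        (Eventually.of_forall fun j => ?_) (Eventually.of_forall fun j => ?_) hkI.norm ?_
      · exact (intervalIntegrable_iff.1 (hkI.continuousOn_mul
          (timeCutoff.contDiff (t := t) (δ := δ j)).continuous.continuousOn)).aestronglyMeasurable
      · refine Eventually.of_forall fun s _ => ?_
        rw [norm_mul]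
        refine mul_le_of_le_one_left (norm_nonneg _) ?_
        rw [Real.norm_eq_abs, timeCutoff, abs_of_nonneg (Real.smoothTransition.nonneg _)]
        exact Real.smoothTransition.le_one _
      · refine Eventually.of_forall fun s _ => ?_
        by_cases hs : s < t
        · rw [indicator_of_mem (show s ∈ Iio t from hs)]
          refine tendsto_const_nhds.congr' ?_
          have : ∀ᶠ j in atTop, δ j < (t - s) / 2 :=
            (tendsto_order.1 hδ0).2 _ (by linarith)
          filter_upwards [this] with j hj
          rw [timeCutoff.eq_one (hδpos j) (by linarith), one_mul]
        · rw [indicator_of_notMem (show s ∉ Iio t from hs)]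
          refine tendsto_const_nhds.congr fun j => ?_
          rw [timeCutoff.eq_zero (hδpos j) (by linarith [hδpos j, not_lt.1 hs]), zero_mul]
    have lim2 : Tendsto (fun j => ∫ s in (0 : ℝ)..T, deriv (timeCutoff t (δ j)) s * g s) atTop
        (𝓝 (-g t)) := by
      rw [Metric.tendsto_nhds]
      intro ε hε
      have hc := Metric.continuousWithinAt_iff.1 (hg t ⟨ht.1.le, ht.2⟩) (ε / 2) (by positivity)
      obtain ⟨r, hr, hrg⟩ := hc
      have : ∀ᶠ j in atTop, δ j < r / 2 := (tendsto_order.1 hδ0).2 _ (by linarith)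
      filter_upwards [this] with j hj
      rw [Real.dist_eq, sub_neg_eq_add]
      refine (timeCutoff.abs_integral_deriv_mul_add_le (ε := ε / 2) (hδpos j) (hδt j) ht.2 hg
        fun s hs => ?_).trans_lt (by linarith)
      have := hrg (x := s) ⟨by linarith [hδt j, hs.1], hs.2.trans ht.2⟩ (by
        rw [Real.dist_eq, abs_sub_comm, abs_of_nonneg (by linarith [hs.2])]
        linarith [hs.1])
      rw [Real.dist_eq] at this
      exact this.le
    have lim := (lim1.add lim2).add_const c
    have h0 := tendsto_nhds_unique lim (tendsto_const_nhds.congr fun j => (hid j).symm)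
    have e : ∫ s in (0 : ℝ)..T, (Iio t).indicator k s = ∫ s in (0 : ℝ)..t, k s := by
      rw [intervalIntegral.integral_of_le hT.le, intervalIntegral.integral_of_le ht.1.le,
        setIntegral_indicator measurableSet_Iio, integral_Ioc_eq_integral_Ioo]
      congr 2
      ext s
      simp only [mem_inter_iff, mem_Ioc, mem_Iio, mem_Ioo]
      exact ⟨fun h => ⟨h.1.1, h.2⟩, fun h => ⟨⟨h.1, h.2.le.trans ht.2⟩, h.2⟩⟩
    rw [e] at h0
    linarith
  intro t ht
  -- No cutoff fits below `t = 0`; there both sides are continuous, and the identity passes to the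
  -- limit from positive times.
  rcases ht.1.eq_or_lt with rfl | ht0
  · have hcont : ContinuousOn (fun t => c + ∫ s in (0 : ℝ)..t, k s) (Icc 0 T) := by
      refine continuousOn_const.add ?_
      have := intervalIntegral.continuousOn_primitive_interval (μ := volume) (f := k) (a := 0)
        (b := T) (by rwa [uIcc_of_le hT.le])
      rwa [uIcc_of_le hT.le] at this
    have l1 : Tendsto g (𝓝[Ioc 0 T] 0) (𝓝 (g 0)) :=
      (hg 0 ht).mono_left (nhdsWithin_mono _ Ioc_subset_Icc_self)
    have l2 : Tendsto (fun t => c + ∫ s in (0 : ℝ)..t, k s) (𝓝[Ioc 0 T] 0)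
        (𝓝 (c + ∫ s in (0 : ℝ)..0, k s)) :=
      (hcont 0 ht).mono_left (nhdsWithin_mono _ Ioc_subset_Icc_self)
    have : (𝓝[Ioc 0 T] (0 : ℝ)).NeBot := by
      rw [← mem_closure_iff_nhdsWithin_neBot, closure_Ioc hT.ne]
      exact ht
    exact tendsto_nhds_unique l1
      (l2.congr' (eventually_nhdsWithin_of_forall fun s hs => (hpos s hs).symm))
  · exact hpos t ⟨ht0, ht.2⟩

/-! ### Density of test functions and duality in `L²` -/

/-- Smooth functions with compact support in an open set are dense in `L²`. -/
lemma dense_Lp_smooth_hasCompactSupport {n : ℕ} {Ω : Set (EuclideanSpace ℝ (Fin n))}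
    (hΩ : IsOpen Ω) :
    Dense {g : Lp ℝ 2 (volume.restrict Ω) | ∃ ψ : EuclideanSpace ℝ (Fin n) → ℝ,
      ContDiff ℝ ∞ ψ ∧ HasCompactSupport ψ ∧ tsupport ψ ⊆ Ω ∧ g =ᵐ[volume.restrict Ω] ψ} := by
  let K : Submodule ℝ (Lp ℝ 2 (volume.restrict Ω)) :=
    { carrier := {g | ∃ ψ : EuclideanSpace ℝ (Fin n) → ℝ,
        ContDiff ℝ ∞ ψ ∧ HasCompactSupport ψ ∧ tsupport ψ ⊆ Ω ∧ g =ᵐ[volume.restrict Ω] ψ}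
      zero_mem' := ⟨0, contDiff_const, HasCompactSupport.zero, by simp [tsupport],
        Lp.coeFn_zero _ _ _⟩
      add_mem' := by
        rintro a b ⟨ψ, h1, h2, h3, h4⟩ ⟨χ, k1, k2, k3, k4⟩
        exact ⟨ψ + χ, h1.add k1, h2.add k2, (tsupport_add ψ χ).trans (union_subset h3 k3),
          (Lp.coeFn_add a b).trans (h4.add k4)⟩
      smul_mem' := by
        rintro r a ⟨ψ, h1, h2, h3, h4⟩
        refine ⟨r • ψ, h1.const_smul r, h2.smul_left (f := fun _ => r),
          (closure_mono (Function.support_const_smul_subset r ψ)).trans h3,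
          (Lp.coeFn_smul r a).trans (h4.const_smul r)⟩ }
  -- Density is equivalent to a trivial orthogonal complement, which is the fundamental lemma of the
  -- calculus of variations.
  have hK : Kᗮ = ⊥ := by
    rw [Submodule.eq_bot_iff]
    intro h hh
    rw [Submodule.mem_orthogonal] at hh
    have hloc : LocallyIntegrableOn h Ω volume :=
      locallyIntegrableOn_of_locallyIntegrable_restrict
        ((Lp.memLp h).locallyIntegrable (by norm_num))
    have h0 := hΩ.ae_eq_zero_of_integral_contDiff_smul_eq_zero hloc (fun ψ h1 h2 h3 => by
      have hmem : MemLp ψ 2 (volume.restrict Ω) :=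
        (h1.continuous.memLp_of_hasCompactSupport h2).restrict Ω
      have := hh (hmem.toLp ψ) ⟨ψ, h1, h2, h3, hmem.coeFn_toLp⟩
      rw [L2.inner_def] at this
      rw [← setIntegral_eq_integral_of_forall_compl_eq_zero (s := Ω), ← this]
      · refine integral_congr_ae ?_
        filter_upwards [hmem.coeFn_toLp] with x hx
        simp [hx, mul_comm]
      · intro x hx
        rw [image_eq_zero_of_notMem_tsupport fun h' => hx (h3 h'), zero_smul])
    rw [Lp.eq_zero_iff_ae_eq_zero]
    exact (ae_restrict_iff' hΩ.measurableSet).2 h0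
  have := (Submodule.topologicalClosure_eq_top_iff (K := K)).2 hK
  exact (Submodule.dense_iff_topologicalClosure_eq_top).2 this

lemma integral_mul_eq_inner {X : Type*} [MeasurableSpace X] {μ : Measure X} (f : Lp ℝ 2 μ)
    {χ : X → ℝ} {g : Lp ℝ 2 μ} (h : g =ᵐ[μ] χ) : ∫ x, f x * χ x ∂μ = inner ℝ g f := by
  rw [L2.inner_def]
  refine integral_congr_ae ?_
  filter_upwards [h] with x hx
  simp [hx]

lemma integrable_Lp_mul {X : Type*} [MeasurableSpace X] {μ : Measure X} (f : Lp ℝ 2 μ)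
    {χ : X → ℝ} (h : MemLp χ 2 μ) : Integrable (fun x => f x * χ x) μ :=
  MemLp.integrable_mul (Lp.memLp f) h

/-- An element of `L²` is bounded by `c` if its pairing with test functions is. -/
lemma Lp.norm_le_of_forall_test {n : ℕ} {Ω : Set (EuclideanSpace ℝ (Fin n))}
    (hΩ : IsOpen Ω) (h : Lp ℝ 2 (volume.restrict Ω)) {c : ℝ} (hc0 : 0 ≤ c)
    (hc : ∀ (ψ : EuclideanSpace ℝ (Fin n) → ℝ) (g : Lp ℝ 2 (volume.restrict Ω)), ContDiff ℝ ∞ ψ →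
      HasCompactSupport ψ → tsupport ψ ⊆ Ω → g =ᵐ[volume.restrict Ω] ψ →
      |∫ x in Ω, h x * ψ x| ≤ c * ‖g‖) : ‖h‖ ≤ c := by
  -- The bound is a closed condition on `g`, so it extends from test functions to all of `L²`, in
  -- particular to `g = h`.
  have hcl : IsClosed {g : Lp ℝ 2 (volume.restrict Ω) | |inner ℝ g h| ≤ c * ‖g‖} :=
    isClosed_le (by fun_prop) (by fun_prop)
  have hmem : h ∈ {g : Lp ℝ 2 (volume.restrict Ω) | |inner ℝ g h| ≤ c * ‖g‖} := by
    refine closure_minimal ?_ hcl (dense_Lp_smooth_hasCompactSupport hΩ h)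
    rintro g ⟨ψ, h1, h2, h3, h4⟩
    have := hc ψ g h1 h2 h3 h4
    rwa [integral_mul_eq_inner h h4] at this
  have hmem' : ‖h‖ * ‖h‖ ≤ c * ‖h‖ := by
    rw [mem_ofPred_eq, real_inner_self_eq_norm_sq, sq] at hmem
    exact (le_abs_self _).trans hmem
  rcases (norm_nonneg h).eq_or_lt with h0 | h0
  · rwa [← h0]
  · exact le_of_mul_le_mul_right hmem' h0

lemma Lp.eq_of_forall_test {n : ℕ} {Ω : Set (EuclideanSpace ℝ (Fin n))}
    (hΩ : IsOpen Ω) (h h' : Lp ℝ 2 (volume.restrict Ω))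
    (hc : ∀ ψ : EuclideanSpace ℝ (Fin n) → ℝ, ContDiff ℝ ∞ ψ →
      HasCompactSupport ψ → tsupport ψ ⊆ Ω → ∫ x in Ω, h x * ψ x = ∫ x in Ω, h' x * ψ x) :
    h = h' := by
  rw [← sub_eq_zero, ← norm_le_zero_iff]
  refine Lp.norm_le_of_forall_test hΩ _ le_rfl fun ψ g h1 h2 h3 h4 => ?_
  have := hc ψ h1 h2 h3
  rw [integral_mul_eq_inner _ h4] at this ⊢
  rw [integral_mul_eq_inner _ h4] at this
  simp [inner_sub_right, this]

/-- The norm of the constant function `1` in `L²(Ω)`. -/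
noncomputable def rootVolume {n : ℕ} (Ω : Set (EuclideanSpace ℝ (Fin n))) : ℝ :=
  measureUnivNNReal (volume.restrict Ω) ^ (2 : ℝ≥0∞).toReal⁻¹

lemma rootVolume_nonneg {n : ℕ} (Ω : Set (EuclideanSpace ℝ (Fin n))) : 0 ≤ rootVolume Ω := by
  unfold rootVolume; positivity

lemma abs_integral_mul_le {n : ℕ} {Ω : Set (EuclideanSpace ℝ (Fin n))}
    [IsFiniteMeasure (volume.restrict Ω)] (f : Lp ℝ 2 (volume.restrict Ω))
    {χ : EuclideanSpace ℝ (Fin n) → ℝ} {A : ℝ} (hA : 0 ≤ A)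
    (hχ : AEStronglyMeasurable χ (volume.restrict Ω)) (hχA : ∀ x, |χ x| ≤ A) :
    |∫ x in Ω, f x * χ x| ≤ ‖f‖ * (rootVolume Ω * A) := by
  have hm : MemLp χ 2 (volume.restrict Ω) :=
    MemLp.of_bound hχ A (Eventually.of_forall hχA)
  have hn : ‖hm.toLp χ‖ ≤ rootVolume Ω * A := by
    refine Lp.norm_le_of_ae_bound hA ?_
    filter_upwards [hm.coeFn_toLp] with x hx
    rw [hx]; exact hχA x
  rw [integral_mul_eq_inner f hm.coeFn_toLp, mul_comm]
  exact (abs_real_inner_le_norm _ _).trans (by gcongr)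

/-! ### The transport pairing and time-independent test functions -/

/-- The elements of `V` are uniformly approximated by regular fields, with uniform bounds. -/
structure IsRegularFamily {n : ℕ} {V : Type*} [NormedAddCommGroup V] [NormedSpace ℝ V]
    (Ω : Set (EuclideanSpace ℝ (Fin n))) (β C : ℝ)
    (ι : V →ₗ[ℝ] (EuclideanSpace ℝ (Fin n) → EuclideanSpace ℝ (Fin n))) : Prop where
  nonneg : 0 ≤ C
  approx : ∀ w, ∀ ε > 0, ∃ φ, IsRegularField Ω β (C * ‖w‖ + ε) φ ∧ ∀ x, ‖ι w x - φ x‖ ≤ ε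

namespace IsRegularFamily

variable {n : ℕ} {V : Type*} [NormedAddCommGroup V] [NormedSpace ℝ V]
  {Ω : Set (EuclideanSpace ℝ (Fin n))} {β C : ℝ}
  {ι : V →ₗ[ℝ] (EuclideanSpace ℝ (Fin n) → EuclideanSpace ℝ (Fin n))}

lemma norm_le (h : IsRegularFamily Ω β C ι) (w : V) (x : EuclideanSpace ℝ (Fin n)) :
    ‖ι w x‖ ≤ C * ‖w‖ := (bounds_of_approx (h.approx w)).1 x

lemma norm_map_sub_le (h : IsRegularFamily Ω β C ι) (w : V) (x y : EuclideanSpace ℝ (Fin n)) :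
    ‖ι w x - ι w y‖ ≤ C * ‖w‖ * ‖x - y‖ := (bounds_of_approx (h.approx w)).2 x y

lemma continuous (h : IsRegularFamily Ω β C ι) (w : V) : Continuous (ι w) := by
  have hC := h.nonneg
  refine (LipschitzWith.of_dist_le_mul (K := (C * ‖w‖).toNNReal) fun x y => ?_).continuous
  rw [Real.coe_toNNReal _ (by positivity), dist_eq_norm, dist_eq_norm]
  exact h.norm_map_sub_le w x y

/-- Evaluation of the vector fields at a point, as a continuous linear map. -/
noncomputable def evalCLM (h : IsRegularFamily Ω β C ι) (x : EuclideanSpace ℝ (Fin n)) :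
    V →L[ℝ] EuclideanSpace ℝ (Fin n) :=
  ((LinearMap.proj x).comp ι).mkContinuous C fun w => h.norm_le w x

/-- The operator `w ↦ w · ∇η` from `V` to `L²(Ω)`. -/
lemma exists_transport_pairing [IsFiniteMeasure (volume.restrict Ω)]
    (h : IsRegularFamily Ω β C ι) {G : ℝ} {η : EuclideanSpace ℝ (Fin n) → ℝ}
    (hη : IsRegularTest Ω β G η) :
    ∃ J : V →L[ℝ] Lp ℝ 2 (volume.restrict Ω),
      (∀ w, J w =ᵐ[volume.restrict Ω] fun x => fderiv ℝ η x (ι w x)) ∧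
      ∀ w, ‖J w‖ ≤ rootVolume Ω * (G * C) * ‖w‖ := by
  have hC := h.nonneg
  have hG := hη.nonneg
  have hb : ∀ w x, ‖fderiv ℝ η x (ι w x)‖ ≤ G * C * ‖w‖ := fun w x => by
    rw [mul_assoc]
    exact (ContinuousLinearMap.le_opNorm _ _).trans
      (mul_le_mul (hη.norm_fderiv_le x) (h.norm_le w x) (norm_nonneg _) hG)
  have hm : ∀ w, MemLp (fun x => fderiv ℝ η x (ι w x)) 2 (volume.restrict Ω) := fun w =>
    MemLp.of_bound (((hη.contDiff.continuous_fderiv (by simp)).clm_apply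
      (h.continuous w)).aestronglyMeasurable) _ (Eventually.of_forall (hb w))
  have hn : ∀ w, ‖(hm w).toLp‖ ≤ rootVolume Ω * (G * C) * ‖w‖ := fun w => by
    rw [mul_assoc]
    refine Lp.norm_le_of_ae_bound (by positivity) ?_
    filter_upwards [(hm w).coeFn_toLp] with x hx
    rw [hx]; exact hb w x
  let J : V →ₗ[ℝ] Lp ℝ 2 (volume.restrict Ω) :=
    { toFun := fun w => (hm w).toLp
      map_add' := fun w w' => by
        rw [← MemLp.toLp_add]
        congr 1
        ext x; simp
      map_smul' := fun r w => by
        rw [RingHom.id_apply, ← MemLp.toLp_const_smul]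
        congr 1
        ext x; simp }
  exact ⟨J.mkContinuous _ hn, fun w => (hm w).coeFn_toLp, hn⟩

end IsRegularFamily

lemma integrableOn_Lp_two {V : Type*} [NormedAddCommGroup V] [NormedSpace ℝ V] {T : ℝ}
    (v : Lp V 2 (volume.restrict (Icc (0 : ℝ) T))) : IntegrableOn v (Icc 0 T) :=
  (Lp.memLp v).integrable (by norm_num)

lemma integrableOn_inner_transport {n : ℕ} {V : Type*} [NormedAddCommGroup V] [NormedSpace ℝ V]
    {Ω : Set (EuclideanSpace ℝ (Fin n))} {T : ℝ} {f : ℝ → Lp ℝ 2 (volume.restrict Ω)}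
    (hf : ContinuousOn f (Icc 0 T)) (v : Lp V 2 (volume.restrict (Icc (0 : ℝ) T)))
    (J : V →L[ℝ] Lp ℝ 2 (volume.restrict Ω)) :
    IntegrableOn (fun s => inner ℝ (f s) (J (v s))) (Icc 0 T) := by
  obtain ⟨F, hF⟩ := isCompact_Icc.exists_bound_of_continuousOn hf
  have hJ := J.continuous.comp_aestronglyMeasurable (Lp.aestronglyMeasurable v)
  refine Integrable.mono' (g := fun s => F * (‖J‖ * ‖v s‖))
    (((integrableOn_Lp_two v).norm.const_mul _).const_mul _)
    ((hf.aestronglyMeasurable measurableSet_Icc).inner hJ) ?_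
  filter_upwards [ae_restrict_mem measurableSet_Icc] with s hs
  exact (norm_inner_le_norm _ _).trans (mul_le_mul (hF s hs) (J.le_opNorm _) (norm_nonneg _)
    ((norm_nonneg _).trans (hF s hs)))

/-- The weak formulation against test functions which do not depend on time. -/
lemma IsWeakSolution.integral_mul_eq {n : ℕ} {V : Type*} [NormedAddCommGroup V]
    [NormedSpace ℝ V] {T : ℝ} {Ω : Set (EuclideanSpace ℝ (Fin n))}
    {ι : V →ₗ[ℝ] (EuclideanSpace ℝ (Fin n) → EuclideanSpace ℝ (Fin n))}
    {f₀ : Lp ℝ 2 (volume.restrict Ω)} {v : Lp V 2 (volume.restrict (Icc (0 : ℝ) T))}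
    {f : ℝ → Lp ℝ 2 (volume.restrict Ω)} (h : IsWeakSolution T Ω ι f₀ v f) (hT : 0 < T)
    {η : EuclideanSpace ℝ (Fin n) → ℝ} (hη : ContDiff ℝ ∞ η) (hc : HasCompactSupport η)
    (hs : tsupport η ⊆ Ω) (J : V →L[ℝ] Lp ℝ 2 (volume.restrict Ω))
    (hJ : ∀ w, J w =ᵐ[volume.restrict Ω] fun x => fderiv ℝ η x (ι w x)) :
    ∀ t ∈ Icc 0 T, ∫ x in Ω, f t x * η x =
      (∫ x in Ω, f₀ x * η x) + ∫ s in (0 : ℝ)..t, inner ℝ (f s) (J (v s)) := by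
  have hm : MemLp η 2 (volume.restrict Ω) := (hη.continuous.memLp_of_hasCompactSupport hc).restrict Ω
  have hd : Differentiable ℝ η := hη.differentiable (by simp)
  -- Products `θ(s) η(x)` as test functions say that `s ↦ ∫ f(s) η` has the distributional
  -- derivative `⟨f(s), v(s) · ∇η⟩` and the initial value `∫ f₀ η`.
  refine eq_add_integral_of_weak_deriv hT ?_ (integrableOn_inner_transport h.continuousOn v J) ?_
  · have : ∀ t, ∫ x in Ω, f t x * η x = inner ℝ (hm.toLp η) (f t) := fun t =>
      integral_mul_eq_inner _ hm.coeFn_toLp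
    simp only [this]
    exact continuousOn_const.inner h.continuousOn
  · intro θ hθ hθc hθs
    have htest : IsTestFunction T Ω (fun p : ℝ × EuclideanSpace ℝ (Fin n) => θ p.1 * η p.2) := by
      have hsub : Function.support (fun p : ℝ × EuclideanSpace ℝ (Fin n) => θ p.1 * η p.2) ⊆
          tsupport θ ×ˢ tsupport η := fun p hp => by
        rw [Function.mem_support, mul_ne_zero_iff] at hp
        exact ⟨subset_tsupport _ hp.1, subset_tsupport _ hp.2⟩
      have hK : IsCompact (tsupport θ ×ˢ tsupport η) := hθc.isCompact.prod hc.isCompact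
      exact ⟨(hθ.comp contDiff_fst).mul (hη.comp contDiff_snd),
        HasCompactSupport.of_support_subset_isCompact hK hsub,
        (closure_minimal hsub hK.isClosed).trans (prod_mono hθs hs)⟩
    have key := h.weak_formulation _ htest
    simp only at key
    have e1 : ∫ x in Ω, f₀ x * (θ 0 * η x) = θ 0 * ∫ x in Ω, f₀ x * η x := by
      rw [← integral_const_mul]
      exact integral_congr_ae (Eventually.of_forall fun x => by ring)
    rw [e1] at key
    refine Eq.trans ?_ key
    congr 1
    refine integral_congr_ae (Eventually.of_forall fun t => ?_)
    have hgrad : ∀ x, inner ℝ (ι (v t) x) (gradient (fun y => θ t * η y) x) =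
        θ t * fderiv ℝ η x (ι (v t) x) := fun x => by
      rw [inner_gradient_right]
      have : fderiv ℝ (fun y => θ t * η y) x = θ t • fderiv ℝ η x :=
        fderiv_const_mul (hd x) _
      rw [this]; simp
    have hder : ∀ x, deriv (fun s => θ s * η x) t = deriv θ t * η x := fun x =>
      deriv_mul_const (hθ.differentiable (by simp) t) _
    simp only [hgrad, hder]
    have i1 : Integrable (fun x => f t x * fderiv ℝ η x (ι (v t) x)) (volume.restrict Ω) :=
      integrable_Lp_mul (f t) ((memLp_congr_ae (hJ (v t))).1 (Lp.memLp _))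
    have i2 : Integrable (fun x => f t x * η x) (volume.restrict Ω) := integrable_Lp_mul (f t) hm
    rw [real_inner_comm, ← integral_mul_eq_inner (f t) (hJ (v t)), ← integral_const_mul,
      ← integral_const_mul, ← integral_add (i1.const_mul _) (i2.const_mul _)]
    exact integral_congr_ae (Eventually.of_forall fun x => by simp only; ring)

lemma IsWeakSolution.initial_eq {n : ℕ} {V : Type*} [NormedAddCommGroup V]
    [NormedSpace ℝ V] {T : ℝ} {Ω : Set (EuclideanSpace ℝ (Fin n))}
    {ι : V →ₗ[ℝ] (EuclideanSpace ℝ (Fin n) → EuclideanSpace ℝ (Fin n))}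
    {f₀ : Lp ℝ 2 (volume.restrict Ω)} {v : Lp V 2 (volume.restrict (Icc (0 : ℝ) T))}
    {f : ℝ → Lp ℝ 2 (volume.restrict Ω)} (h : IsWeakSolution T Ω ι f₀ v f) (hT : 0 < T)
    [IsFiniteMeasure (volume.restrict Ω)] (hΩ : IsOpen Ω) {β C : ℝ} (hβ : 0 < β) (hβ1 : β ≤ 1)
    (hι : IsRegularFamily Ω β C ι) : f 0 = f₀ := by
  refine Lp.eq_of_forall_test hΩ _ _ fun ψ h1 h2 h3 => ?_
  obtain ⟨G, hG⟩ := exists_isRegularTest hβ hβ1 h1 h2 h3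
  obtain ⟨J, hJ, -⟩ := hι.exists_transport_pairing hG
  simpa using h.integral_mul_eq hT h1 h2 h3 J hJ 0 ⟨le_rfl, hT.le⟩

/-! ### Consistency of the Euler scheme along a weak solution -/

lemma IsRegularField.mono {n : ℕ} {Ω : Set (EuclideanSpace ℝ (Fin n))} {β m m' : ℝ}
    {φ : EuclideanSpace ℝ (Fin n) → EuclideanSpace ℝ (Fin n)} (h : IsRegularField Ω β m φ)
    (hm : m ≤ m') : IsRegularField Ω β m' φ :=
  ⟨h.contDiff, h.hasCompactSupport, h.tsupport_subset, fun x => (h.norm_le x).trans hm,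
    fun x => (h.norm_fderiv_le x).trans hm,
    fun x hx y hy => (h.norm_fderiv_sub_le x hx y hy).trans (by gcongr)⟩

lemma continuous_eulerMap {E : Type*} [TopologicalSpace E] [Add E] [ContinuousAdd E]
    {a : ℕ → E → E} {N : ℕ} (ha : ∀ l < N, Continuous (a l)) : Continuous (eulerMap a N) := by
  induction N with
  | zero => exact continuous_id
  | succ N ih =>
    have h := ih fun l hl => ha l (hl.trans (Nat.lt_succ_self N))
    exact h.add ((ha N (Nat.lt_succ_self N)).comp h)

lemma intervalIntegrable_of_mem_Icc {V : Type*} [NormedAddCommGroup V] {T a b : ℝ} {v : ℝ → V}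
    (hv : IntegrableOn v (Icc 0 T)) (ha : a ∈ Icc 0 T) (hb : b ∈ Icc 0 T) :
    IntervalIntegrable v volume a b :=
  (hv.mono_set (uIcc_subset_Icc ha hb)).intervalIntegrable

/-- Consistency error of one Euler step along a weak solution. -/
lemma IsWeakSolution.abs_step_le {n : ℕ} {V : Type*} [NormedAddCommGroup V]
    [NormedSpace ℝ V] [CompleteSpace V] {T : ℝ} {Ω : Set (EuclideanSpace ℝ (Fin n))}
    {ι : V →ₗ[ℝ] (EuclideanSpace ℝ (Fin n) → EuclideanSpace ℝ (Fin n))}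
    {f₀ : Lp ℝ 2 (volume.restrict Ω)} {v : Lp V 2 (volume.restrict (Icc (0 : ℝ) T))}
    {f : ℝ → Lp ℝ 2 (volume.restrict Ω)} (h : IsWeakSolution T Ω ι f₀ v f) (hT : 0 < T)
    [IsFiniteMeasure (volume.restrict Ω)] (hΩ : Convex ℝ Ω) {β C G m δ τ F a b : ℝ} (hβ : 0 < β)
    (hι : IsRegularFamily Ω β C ι) {η : EuclideanSpace ℝ (Fin n) → ℝ}
    (hη : IsRegularTest Ω β G η) {φ : EuclideanSpace ℝ (Fin n) → EuclideanSpace ℝ (Fin n)}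
    (hφ : IsRegularField Ω β m φ) (hm : m ≤ 1 / 2) (ha : 0 ≤ a) (hab : a ≤ b) (hb : b ≤ T)
    (hδ : ∀ x, ‖ι (∫ s in a..b, v s) x - φ x‖ ≤ δ) (hτ : ∀ s ∈ Icc a b, ‖f s - f a‖ ≤ τ)
    (hF : ‖f a‖ ≤ F) :
    |(∫ x in Ω, f b x * η x) - ∫ x in Ω, f a x * η (x + φ x)| ≤
      rootVolume Ω * G * (τ * (C * ∫ s in a..b, ‖v s‖) + F * δ + F * (m ^ β * m)) := by
  obtain ⟨J, hJ, hJn⟩ := hι.exists_transport_pairing hη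
  have hC := hι.nonneg
  have hG := hη.nonneg
  have hκ := rootVolume_nonneg Ω
  have hm0 := hφ.nonneg
  have hδ0 : 0 ≤ δ := (norm_nonneg _).trans (hδ 0)
  have haT : a ∈ Icc 0 T := ⟨ha, hab.trans hb⟩
  have hbT : b ∈ Icc 0 T := ⟨ha.trans hab, hb⟩
  have h0T : (0 : ℝ) ∈ Icc 0 T := ⟨le_rfl, hT.le⟩
  have hint := integrableOn_inner_transport h.continuousOn v J
  have hvI := integrableOn_Lp_two v
  have hw := h.integral_mul_eq hT hη.contDiff hη.hasCompactSupport hη.tsupport_subset J hJ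
  have e1 : (∫ x in Ω, f b x * η x) - ∫ x in Ω, f a x * η x =
      ∫ s in a..b, inner ℝ (f s) (J (v s)) := by
    rw [hw b hbT, hw a haT, ← intervalIntegral.integral_add_adjacent_intervals
      (intervalIntegrable_of_mem_Icc hint h0T haT) (intervalIntegrable_of_mem_Icc hint haT hbT)]
    ring
  -- Once `f` is frozen at time `a`, the integrand is a bounded linear functional of `v s`, so only
  -- the time integral of `v` matters.
  have e2 : ∫ s in a..b, inner ℝ (f a) (J (v s)) =
      ∫ x in Ω, f a x * fderiv ℝ η x (ι (∫ s in a..b, v s) x) := by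
    rw [integral_mul_eq_inner (f a) (hJ _), real_inner_comm]
    exact ((innerSL ℝ (f a)).comp J).intervalIntegral_comp_comm
      (intervalIntegrable_of_mem_Icc hvI haT hbT)
  have hI1 : IntervalIntegrable (fun s => inner ℝ (f a) (J (v s))) volume a b :=
    intervalIntegrable_of_mem_Icc
      (((innerSL ℝ (f a)).comp J).integrable_comp hvI) haT hbT
  have hI2 := intervalIntegrable_of_mem_Icc hint haT hbT
  -- Cost of freezing `f` at time `a`, controlled by its oscillation `τ` on the step.
  have b1 : |(∫ s in a..b, inner ℝ (f s) (J (v s))) - ∫ s in a..b, inner ℝ (f a) (J (v s))| ≤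
      rootVolume Ω * G * (τ * (C * ∫ s in a..b, ‖v s‖)) := by
    rw [← intervalIntegral.integral_sub hI2 hI1]
    have hI3 : IntervalIntegrable (fun s => τ * (rootVolume Ω * (G * C) * ‖v s‖)) volume a b :=
      ((intervalIntegrable_of_mem_Icc hvI haT hbT).norm.const_mul _).const_mul _
    have := intervalIntegral.norm_integral_le_of_norm_le (μ := volume) hab
      (f := fun s => inner ℝ (f s) (J (v s)) - inner ℝ (f a) (J (v s)))
      (Eventually.of_forall fun s hs => ?_) hI3
    · rw [intervalIntegral.integral_const_mul, intervalIntegral.integral_const_mul] at this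
      refine this.trans_eq ?_
      ring
    · rw [← inner_sub_left]
      exact (norm_inner_le_norm _ _).trans (mul_le_mul (hτ s ⟨hs.1.le, hs.2⟩) (hJn _)
        (norm_nonneg _) ((norm_nonneg _).trans (hτ s ⟨hs.1.le, hs.2⟩)))
  have mη : MemLp η 2 (volume.restrict Ω) :=
    (hη.contDiff.continuous.memLp_of_hasCompactSupport hη.hasCompactSupport).restrict Ω
  have mD : MemLp (fun x => fderiv ℝ η x (ι (∫ s in a..b, v s) x)) 2 (volume.restrict Ω) :=
    (memLp_congr_ae (hJ _)).1 (Lp.memLp _)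
  have mT : MemLp (fun x => η (x + φ x)) 2 (volume.restrict Ω) := by
    obtain ⟨A, hA⟩ := hη.hasCompactSupport.exists_bound_of_continuous hη.contDiff.continuous
    exact MemLp.of_bound (hη.contDiff.continuous.comp
      (continuous_id.add hφ.contDiff.continuous)).aestronglyMeasurable A
      (Eventually.of_forall fun x => hA _)
  have e3 : (∫ x in Ω, f a x * η x) + (∫ x in Ω, f a x * fderiv ℝ η x (ι (∫ s in a..b, v s) x))
      - ∫ x in Ω, f a x * η (x + φ x) =
      ∫ x in Ω, f a x * (η x + fderiv ℝ η x (ι (∫ s in a..b, v s) x) - η (x + φ x)) := by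
    have i1 := integrable_Lp_mul (f a) mη
    have i2 := integrable_Lp_mul (f a) mD
    have i12 : Integrable (fun x => f a x * η x +
      f a x * fderiv ℝ η x (ι (∫ s in a..b, v s) x)) (volume.restrict Ω) := i1.add i2
    rw [← integral_add i1 i2, ← integral_sub i12 (integrable_Lp_mul (f a) mT)]
    exact integral_congr_ae (Eventually.of_forall fun x => by simp only; ring)
  -- Spatial error: `G * δ` for replacing the true increment by `φ`, and the Taylor remainder of
  -- `η`.
  have b2 : |∫ x in Ω, f a x * (η x + fderiv ℝ η x (ι (∫ s in a..b, v s) x) - η (x + φ x))| ≤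
      ‖f a‖ * (rootVolume Ω * (G * δ + G * (m ^ β * m))) := by
    refine abs_integral_mul_le (f a) (by positivity)
      ((mη.add mD).sub mT).aestronglyMeasurable fun x => ?_
    have t1 := hη.taylor_le hφ hm hβ hΩ x
    have t2 : |fderiv ℝ η x (ι (∫ s in a..b, v s) x - φ x)| ≤ G * δ :=
      (ContinuousLinearMap.le_opNorm _ _).trans
        (mul_le_mul (hη.norm_fderiv_le x) (hδ x) (norm_nonneg _) hG)
    rw [map_sub] at t2
    have e : η x + fderiv ℝ η x (ι (∫ s in a..b, v s) x) - η (x + φ x) =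
        (fderiv ℝ η x (ι (∫ s in a..b, v s) x) - fderiv ℝ η x (φ x)) -
        (η (x + φ x) - η x - fderiv ℝ η x (φ x)) := by ring
    rw [e]
    exact (abs_sub _ _).trans (add_le_add t2 t1)
  have e4 : (∫ x in Ω, f b x * η x) - ∫ x in Ω, f a x * η (x + φ x) =
      ((∫ s in a..b, inner ℝ (f s) (J (v s))) - ∫ s in a..b, inner ℝ (f a) (J (v s))) +
      ∫ x in Ω, f a x * (η x + fderiv ℝ η x (ι (∫ s in a..b, v s) x) - η (x + φ x)) := by
    rw [← e3, ← e1, e2]; ring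
  rw [e4]
  calc _ ≤ rootVolume Ω * G * (τ * (C * ∫ s in a..b, ‖v s‖)) +
        ‖f a‖ * (rootVolume Ω * (G * δ + G * (m ^ β * m))) :=
        (abs_add_le _ _).trans (add_le_add b1 b2)
    _ ≤ rootVolume Ω * G * (τ * (C * ∫ s in a..b, ‖v s‖)) +
        F * (rootVolume Ω * (G * δ + G * (m ^ β * m))) := by gcongr
    _ = _ := by ring

/-- Consistency error of an Euler scheme along a weak solution. -/
lemma IsWeakSolution.abs_eulerMap_le {n : ℕ} {V : Type*} [NormedAddCommGroup V]
    [NormedSpace ℝ V] [CompleteSpace V] {T : ℝ} {Ω : Set (EuclideanSpace ℝ (Fin n))}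
    {ι : V →ₗ[ℝ] (EuclideanSpace ℝ (Fin n) → EuclideanSpace ℝ (Fin n))}
    {f₀ : Lp ℝ 2 (volume.restrict Ω)} {v : Lp V 2 (volume.restrict (Icc (0 : ℝ) T))}
    {f : ℝ → Lp ℝ 2 (volume.restrict Ω)} (h : IsWeakSolution T Ω ι f₀ v f) (hT : 0 < T)
    [IsFiniteMeasure (volume.restrict Ω)] (hΩ : Convex ℝ Ω) {β C δ τ F : ℝ} (hβ : 0 < β)
    (hβ1 : β ≤ 1) (hι : IsRegularFamily Ω β C ι)
    {φ : ℕ → EuclideanSpace ℝ (Fin n) → EuclideanSpace ℝ (Fin n)} {m p : ℕ → ℝ} {N : ℕ}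
    (hφ : ∀ l < N, IsRegularField Ω β (m l) (φ l)) (hm : ∀ l < N, m l ≤ 1 / 2)
    (hp : Monotone p) (hpT : ∀ l ≤ N, p l ∈ Icc 0 T)
    (hδ : ∀ l < N, ∀ x, ‖ι (∫ s in p l..p (l + 1), v s) x - φ l x‖ ≤ δ)
    (hτ : ∀ l < N, ∀ s ∈ Icc (p l) (p (l + 1)), ‖f s - f (p l)‖ ≤ τ)
    (hF : ∀ s ∈ Icc 0 T, ‖f s‖ ≤ F) {G : ℝ} {η : EuclideanSpace ℝ (Fin n) → ℝ}
    (hη : IsRegularTest Ω β G η) :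
    |(∫ x in Ω, f (p N) x * η x) - ∫ x in Ω, f (p 0) x * η (eulerMap φ N x)| ≤
      rootVolume Ω * G * Real.exp (4 * ∑ l ∈ Finset.range N, m l) *
        ∑ l ∈ Finset.range N, (τ * (C * ∫ s in p l..p (l + 1), ‖v s‖) + F * δ +
          F * (m l ^ β * m l)) := by
  have hC := hι.nonneg
  have hκ := rootVolume_nonneg Ω
  -- The test function must vary: the last step is peeled off, and the induction hypothesis is
  -- applied to the pull-back of `η` under it, with the constant `G * (1 + 4 * m N)`.
  induction N generalizing G η with
  | zero => simp [eulerMap]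
  | succ N ih =>
    have hN := Nat.lt_succ_self N
    have hG := hη.nonneg
    have hpN := hpT N hN.le
    have hpN1 := hpT (N + 1) le_rfl
    have hmN := (hφ N hN).nonneg
    have h1 := h.abs_step_le hT hΩ hβ hι hη (hφ N hN) (hm N hN) hpN.1 (hp hN.le) hpN1.2 (hδ N hN)
      (hτ N hN) (hF _ hpN)
    have h2 := ih (fun l hl => hφ l (hl.trans hN)) (fun l hl => hm l (hl.trans hN))
      (fun l hl => hpT l (hl.trans hN.le)) (fun l hl => hδ l (hl.trans hN))
      (fun l hl => hτ l (hl.trans hN)) (hη.comp_add (hφ N hN) (hm N hN) hβ hβ1)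
    have hpos : ∀ l < N + 1, 0 ≤ τ * (C * ∫ s in p l..p (l + 1), ‖v s‖) + F * δ +
          F * (m l ^ β * m l) := fun l hl => by
      have hml := (hφ l hl).nonneg
      have hτ0 : 0 ≤ τ := (norm_nonneg _).trans (hτ l hl (p l) ⟨le_rfl, hp (Nat.le_succ l)⟩)
      have hδ0 : 0 ≤ δ := (norm_nonneg _).trans (hδ l hl 0)
      have hF0 : 0 ≤ F := (norm_nonneg _).trans (hF _ hpN)
      have hi : 0 ≤ ∫ s in p l..p (l + 1), ‖v s‖ :=
        intervalIntegral.integral_nonneg (hp (Nat.le_succ l)) fun _ _ => norm_nonneg _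
      positivity
    rw [Finset.sum_range_succ, Finset.sum_range_succ _ N]
    set S := ∑ l ∈ Finset.range N, m l with hS
    set E := ∑ l ∈ Finset.range N, (τ * (C * ∫ s in p l..p (l + 1), ‖v s‖) + F * δ +
          F * (m l ^ β * m l)) with hE
    set e := τ * (C * ∫ s in p N..p (N + 1), ‖v s‖) + F * δ + F * (m N ^ β * m N) with he
    have hS0 : 0 ≤ S := Finset.sum_nonneg fun l hl =>
      (hφ l ((Finset.mem_range.1 hl).trans hN)).nonneg
    have hE0 : 0 ≤ E := Finset.sum_nonneg fun l hl => hpos l ((Finset.mem_range.1 hl).trans hN)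
    have he0 : 0 ≤ e := hpos N hN
    have x1 : (1 + 4 * m N) * Real.exp (4 * S) ≤ Real.exp (4 * (S + m N)) := by
      rw [mul_add, Real.exp_add, mul_comm]
      gcongr
      rw [add_comm]; exact Real.add_one_le_exp _
    have x2 : 1 ≤ Real.exp (4 * (S + m N)) := Real.one_le_exp (by positivity)
    calc _ ≤ |(∫ x in Ω, f (p (N + 1)) x * η x) - ∫ x in Ω, f (p N) x * η (x + φ N x)| +
          |(∫ x in Ω, f (p N) x * η (x + φ N x)) -
            ∫ x in Ω, f (p 0) x * η (eulerMap φ (N + 1) x)| := abs_sub_le _ _ _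
      _ ≤ rootVolume Ω * G * e + rootVolume Ω * (G * (1 + 4 * m N)) * Real.exp (4 * S) * E :=
          add_le_add h1 h2
      _ = rootVolume Ω * G * (1 * e + ((1 + 4 * m N) * Real.exp (4 * S)) * E) := by ring
      _ ≤ rootVolume Ω * G * (Real.exp (4 * (S + m N)) * e + Real.exp (4 * (S + m N)) * E) := by
          gcongr
      _ = _ := by ring

/-! ### Euler schemes on uniform meshes -/

/-- Cauchy–Schwarz in time. -/
lemma integral_norm_le_sqrt_mul {V : Type*} [NormedAddCommGroup V] [NormedSpace ℝ V] {T a b : ℝ}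
    (v : Lp V 2 (volume.restrict (Icc (0 : ℝ) T))) (ha : 0 ≤ a) (hab : a ≤ b) (hb : b ≤ T) :
    ∫ s in a..b, ‖v s‖ ≤ √(b - a) * ‖v‖ := by
  have hsub : Ioc a b ⊆ Icc 0 T := fun s hs => ⟨ha.trans hs.1.le, hs.2.trans hb⟩
  have hmeas : AEStronglyMeasurable v (volume.restrict (Ioc a b)) :=
    (Lp.aestronglyMeasurable v).mono_measure (Measure.restrict_mono hsub le_rfl)
  have h1 := eLpNorm_le_eLpNorm_mul_rpow_measure_univ (μ := volume.restrict (Ioc a b))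
    (p := 1) (q := 2) (by norm_num) hmeas
  have h2 : eLpNorm v 2 (volume.restrict (Ioc a b)) ≤ eLpNorm v 2 (volume.restrict (Icc 0 T)) :=
    eLpNorm_mono_measure _ (Measure.restrict_mono hsub le_rfl)
  rw [intervalIntegral.integral_of_le hab, integral_norm_eq_lintegral_enorm hmeas,
    ← eLpNorm_one_eq_lintegral_enorm, Lp.norm_def, mul_comm]
  have h3 : √(b - a) = (volume.restrict (Ioc a b) univ ^ (1 / (1 : ℝ≥0∞).toReal -
      1 / (2 : ℝ≥0∞).toReal)).toReal := by
    rw [Measure.restrict_apply_univ, Real.volume_Ioc, ← ENNReal.toReal_rpow,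
      ENNReal.toReal_ofReal (by linarith), Real.sqrt_eq_rpow]
    norm_num
  rw [h3, ← ENNReal.toReal_mul]
  refine ENNReal.toReal_mono (ENNReal.mul_ne_top (Lp.eLpNorm_ne_top v) ?_)
    (h1.trans (by gcongr))
  exact ENNReal.rpow_ne_top_of_nonneg (by norm_num) (by simp)

/-- The points of the uniform mesh of `[0, t]` with `N` intervals. -/
noncomputable def mesh (t : ℝ) (N l : ℕ) : ℝ := t * l / N

section mesh

variable {t : ℝ} {N : ℕ}

@[simp]
lemma mesh_zero : mesh t N 0 = 0 := by simp [mesh]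

lemma mesh_self (hN : N ≠ 0) : mesh t N N = t := by
  unfold mesh; field_simp

lemma mesh_monotone (ht : 0 ≤ t) : Monotone (mesh t N) := fun a b hab => by
  unfold mesh; gcongr

lemma mesh_mem {T : ℝ} (ht : t ∈ Icc 0 T) (hN : N ≠ 0) {l : ℕ} (hl : l ≤ N) :
    mesh t N l ∈ Icc 0 T := by
  constructor
  · rw [← mesh_zero (t := t) (N := N)]; exact mesh_monotone ht.1 (Nat.zero_le l)
  · refine le_trans ?_ ht.2
    calc mesh t N l ≤ mesh t N N := mesh_monotone ht.1 hl
      _ = t := mesh_self hN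

lemma mesh_succ_sub (l : ℕ) : mesh t N (l + 1) - mesh t N l = t / N := by
  unfold mesh; push_cast; ring

lemma mesh_mul {M : ℕ} (hM : M ≠ 0) (l : ℕ) : mesh t (N * M) (l * M) = mesh t N l := by
  unfold mesh
  have : (M : ℝ) ≠ 0 := by exact_mod_cast hM
  push_cast
  rw [← mul_assoc, mul_div_mul_right _ _ this]

end mesh

lemma sum_integral_mesh {V : Type*} [NormedAddCommGroup V] {T : ℝ} {v : ℝ → V} (hv : IntegrableOn v (Icc 0 T)) {t : ℝ} (ht : t ∈ Icc 0 T)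
    {N : ℕ} (hN : N ≠ 0) :
    ∑ l ∈ Finset.range N, ∫ s in mesh t N l..mesh t N (l + 1), ‖v s‖ =
      ∫ s in (0 : ℝ)..t, ‖v s‖ := by
  rw [intervalIntegral.sum_integral_adjacent_intervals fun k hk =>
    intervalIntegrable_of_mem_Icc hv.norm (mesh_mem ht hN hk.le) (mesh_mem ht hN hk)]
  rw [mesh_zero, mesh_self hN]

section euler

variable {n : ℕ} {V : Type*} [NormedAddCommGroup V] [NormedSpace ℝ V]
  {Ω : Set (EuclideanSpace ℝ (Fin n))} {β C T : ℝ}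
  {ι : V →ₗ[ℝ] (EuclideanSpace ℝ (Fin n) → EuclideanSpace ℝ (Fin n))}

/-- The increments of the Euler scheme for the velocity field `v` on `[0, t]` with `N` steps. -/
noncomputable def eulerField (ι : V →ₗ[ℝ] (EuclideanSpace ℝ (Fin n) → EuclideanSpace ℝ (Fin n)))
    (v : ℝ → V) (t : ℝ) (N l : ℕ) : EuclideanSpace ℝ (Fin n) → EuclideanSpace ℝ (Fin n) :=
  ι (∫ s in mesh t N l..mesh t N (l + 1), v s)

/-- Several small Euler steps against a large one. -/
lemma IsRegularFamily.norm_multistep_sub_le (hι : IsRegularFamily Ω β C ι) {v : ℝ → V}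
    (hv : IntegrableOn v (Icc 0 T)) {p : ℕ → ℝ} (hp : Monotone p) {M : ℕ}
    (hpT : ∀ j ≤ M, p j ∈ Icc 0 T) {z : ℕ → EuclideanSpace ℝ (Fin n)}
    (hz : ∀ j < M, z (j + 1) = z j + ι (∫ s in p j..p (j + 1), v s) (z j)) :
    ‖z M - z 0‖ ≤ C * ∫ s in p 0..p M, ‖v s‖ ∧
    ‖ι (∫ s in p 0..p M, v s) (z 0) - (z M - z 0)‖ ≤ (C * ∫ s in p 0..p M, ‖v s‖) ^ 2 := by
  have hC := hι.nonneg
  induction M with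
  | zero => simp
  | succ M ih =>
    have hM := Nat.lt_succ_self M
    obtain ⟨ih1, ih2⟩ := ih (fun j hj => hpT j (hj.trans hM.le)) fun j hj => hz j (hj.trans hM)
    have h0 := hpT 0 (Nat.zero_le _)
    have hMT := hpT M hM.le
    have hM1 := hpT (M + 1) le_rfl
    have a1 : ∫ s in p 0..p (M + 1), v s =
        (∫ s in p 0..p M, v s) + ∫ s in p M..p (M + 1), v s :=
      (intervalIntegral.integral_add_adjacent_intervals (intervalIntegrable_of_mem_Icc hv h0 hMT)
        (intervalIntegrable_of_mem_Icc hv hMT hM1)).symm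
    have a2 : ∫ s in p 0..p (M + 1), ‖v s‖ =
        (∫ s in p 0..p M, ‖v s‖) + ∫ s in p M..p (M + 1), ‖v s‖ :=
      (intervalIntegral.integral_add_adjacent_intervals
        (intervalIntegrable_of_mem_Icc hv.norm h0 hMT)
        (intervalIntegrable_of_mem_Icc hv.norm hMT hM1)).symm
    have hY : ‖∫ s in p M..p (M + 1), v s‖ ≤ ∫ s in p M..p (M + 1), ‖v s‖ :=
      intervalIntegral.norm_integral_le_integral_norm (hp hM.le)
    have hy0 : 0 ≤ ∫ s in p 0..p M, ‖v s‖ :=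
      intervalIntegral.integral_nonneg (hp (Nat.zero_le _)) fun _ _ => norm_nonneg _
    rw [a2, hz M hM, a1]
    set Y := ∫ s in p M..p (M + 1), v s
    set b := ∫ s in p M..p (M + 1), ‖v s‖
    set a := ∫ s in p 0..p M, ‖v s‖
    have hb0 : 0 ≤ b := (norm_nonneg _).trans hY
    constructor
    · have e : z M + ι Y (z M) - z 0 = (z M - z 0) + ι Y (z M) := by abel
      rw [e, mul_add]
      exact (norm_add_le _ _).trans (add_le_add ih1 ((hι.norm_le _ _).trans (by gcongr)))
    -- The large step evaluates the new increment at `z 0`, the small step at `z M`. The Lipschitz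
    -- constant `C * b` times the displacement `C * a` bounds the difference, and it fits into the
    -- cross term of the square.
    · have e : ι ((∫ s in p 0..p M, v s) + Y) (z 0) - (z M + ι Y (z M) - z 0) =
          (ι (∫ s in p 0..p M, v s) (z 0) - (z M - z 0)) + -(ι Y (z M) - ι Y (z 0)) := by
        rw [map_add, Pi.add_apply]; abel
      rw [e]
      calc _ ≤ (C * a) ^ 2 + C * b * (C * a) := by
            refine (norm_add_le _ _).trans (add_le_add ih2 ?_)
            rw [norm_neg]
            refine (hι.norm_map_sub_le _ _ _).trans ?_
            gcongr
        _ ≤ (C * (a + b)) ^ 2 := by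
            have : 0 ≤ C * a * (C * b) := by positivity
            nlinarith [sq_nonneg (C * b)]

variable (v : Lp V 2 (volume.restrict (Icc (0 : ℝ) T))) {R t : ℝ}

lemma sum_mul_integral_mesh_le (hC : 0 ≤ C) (hR : ‖v‖ ≤ R) (ht : t ∈ Icc 0 T) {N : ℕ}
    (hN : N ≠ 0) :
    ∑ l ∈ Finset.range N, C * ∫ s in mesh t N l..mesh t N (l + 1), ‖v s‖ ≤ C * (√T * R) := by
  rw [← Finset.mul_sum, sum_integral_mesh (integrableOn_Lp_two v) ht hN]
  gcongr
  refine (integral_norm_le_sqrt_mul v le_rfl ht.1 ht.2).trans ?_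
  gcongr
  rw [sub_zero]; exact ht.2

lemma mul_integral_mesh_le (hC : 0 ≤ C) (hR : ‖v‖ ≤ R) (ht : t ∈ Icc 0 T) {N : ℕ}
    (hN : N ≠ 0) {l : ℕ} (hl : l < N) :
    C * ∫ s in mesh t N l..mesh t N (l + 1), ‖v s‖ ≤ C * (√T * R) / √N := by
  have hR0 : 0 ≤ R := (norm_nonneg _).trans hR
  have h := integral_norm_le_sqrt_mul v (mesh_mem ht hN hl.le).1
    (mesh_monotone ht.1 (Nat.le_succ l)) (mesh_mem ht hN hl).2
  rw [mesh_succ_sub, Real.sqrt_div ht.1] at h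
  calc _ ≤ C * (√t / √N * ‖v‖) := by gcongr
    _ ≤ C * (√T / √N * R) := by
        have := ht.2
        gcongr
    _ = _ := by ring

lemma IsRegularFamily.norm_eulerField_sub_le (hι : IsRegularFamily Ω β C ι) (ht : t ∈ Icc 0 T)
    {N l : ℕ} (x z : EuclideanSpace ℝ (Fin n)) :
    ‖eulerField ι v t N l x - eulerField ι v t N l z‖ ≤
      (C * ∫ s in mesh t N l..mesh t N (l + 1), ‖v s‖) * ‖x - z‖ := by
  have hC := hι.nonneg
  refine (hι.norm_map_sub_le _ _ _).trans ?_
  gcongr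
  exact intervalIntegral.norm_integral_le_integral_norm (mesh_monotone ht.1 (Nat.le_succ l))

/-- Euler schemes with `N` and with `N * M` steps differ by `O(N ^ (-1/2))`. -/
lemma IsRegularFamily.norm_eulerMap_sub_refine_le (hι : IsRegularFamily Ω β C ι) (hR : ‖v‖ ≤ R)
    (ht : t ∈ Icc 0 T) {N M : ℕ} (hN : N ≠ 0) (hM : M ≠ 0) (x : EuclideanSpace ℝ (Fin n)) :
    ‖eulerMap (eulerField ι v t N) N x - eulerMap (eulerField ι v t (N * M)) (N * M) x‖ ≤
      Real.exp (C * (√T * R)) * ((C * (√T * R)) ^ 2 / √N) := by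
  have hC := hι.nonneg
  have hR0 : 0 ≤ R := (norm_nonneg _).trans hR
  have hNM : N * M ≠ 0 := Nat.mul_ne_zero hN hM
  have hv := integrableOn_Lp_two v
  set z : ℕ → EuclideanSpace ℝ (Fin n) := fun j => eulerMap (eulerField ι v t (N * M)) j x
  have hpos : ∀ l, 0 ≤ C * ∫ s in mesh t N l..mesh t N (l + 1), ‖v s‖ := fun l =>
    mul_nonneg hC (intervalIntegral.integral_nonneg (mesh_monotone ht.1 (Nat.le_succ l))
      fun _ _ => norm_nonneg _)
  -- The fine polygon, sampled at every `M`-th node, is the comparison sequence in the discrete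
  -- Grönwall estimate for the coarse one.
  have h := norm_eulerMap_sub_le (a := eulerField ι v t N) (y := fun l => z (l * M)) (N := N)
    (m := fun l => C * ∫ s in mesh t N l..mesh t N (l + 1), ‖v s‖)
    (e := fun l => (C * ∫ s in mesh t N l..mesh t N (l + 1), ‖v s‖) ^ 2)
    (fun l _ => hpos l) (fun l _ => hι.norm_eulerField_sub_le v ht) (fun l hl => ?_)
  · have hz0 : z (0 * M) = x := by simp [z, eulerMap]
    simp only [hz0] at h
    refine h.trans ?_
    have hS := sum_mul_integral_mesh_le v hC hR ht hN
    gcongr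
    -- A sum of squares is at most the largest term, which is `O(N^(-1/2))` by Cauchy–Schwarz on one
    -- step, times the bounded sum.
    calc _ ≤ ∑ l ∈ Finset.range N, (C * (√T * R) / √N) *
          (C * ∫ s in mesh t N l..mesh t N (l + 1), ‖v s‖) := by
          refine Finset.sum_le_sum fun l hl => ?_
          rw [sq]
          exact mul_le_mul_of_nonneg_right
            (mul_integral_mesh_le v hC hR ht hN (Finset.mem_range.1 hl)) (hpos l)
      _ ≤ (C * (√T * R) / √N) * (C * (√T * R)) := by
          rw [← Finset.mul_sum]; gcongr
      _ = _ := by ring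
  · have hle : ∀ j ≤ M, l * M + j ≤ N * M := fun j hj =>
      calc l * M + j ≤ l * M + M := by gcongr
        _ = (l + 1) * M := by ring
        _ ≤ N * M := by gcongr; exact hl
    have := (hι.norm_multistep_sub_le hv (p := fun j => mesh t (N * M) (l * M + j)) (M := M)
      (fun a b hab => mesh_monotone ht.1 (by gcongr))
      (fun j hj => mesh_mem ht hNM (hle j hj)) (z := fun j => z (l * M + j))
      (fun j _ => rfl)).2
    simp only [add_zero] at this
    rw [show l * M + M = (l + 1) * M by ring, mesh_mul hM, mesh_mul hM] at this
    exact this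

/-- Approximation of an Euler scheme by smooth perturbations of the identity. -/
lemma IsRegularFamily.exists_fields (hι : IsRegularFamily Ω β C ι) (hR : ‖v‖ ≤ R)
    (ht : t ∈ Icc 0 T) {N : ℕ} (hN : N ≠ 0) :
    ∃ (φ : ℕ → EuclideanSpace ℝ (Fin n) → EuclideanSpace ℝ (Fin n)) (m : ℕ → ℝ),
      (∀ l < N, IsRegularField Ω β (m l) (φ l)) ∧
      (∀ l < N, m l ≤ (C * (√T * R) + 1) / √N) ∧
      ∑ l ∈ Finset.range N, m l ≤ C * (√T * R) + 1 ∧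
      (∀ l < N, ∀ x, ‖eulerField ι v t N l x - φ l x‖ ≤ 1 / (N : ℝ) ^ 2) ∧
      ∀ x, ‖eulerMap φ N x - eulerMap (eulerField ι v t N) N x‖ ≤
        Real.exp (C * (√T * R) + 1) / N := by
  have hC := hι.nonneg
  have hN1 : (1 : ℝ) ≤ N := by exact_mod_cast Nat.one_le_iff_ne_zero.2 hN
  have hε : 0 < 1 / (N : ℝ) ^ 2 := by positivity
  -- With tolerance `1 / N ^ 2` per step, the `N` errors add up to `1 / N`.
  choose φ hφ hφ' using fun l => hι.approx (∫ s in mesh t N l..mesh t N (l + 1), v s)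
    (1 / (N : ℝ) ^ 2) hε
  set m : ℕ → ℝ := fun l => (C * ∫ s in mesh t N l..mesh t N (l + 1), ‖v s‖) + 1 / (N : ℝ) ^ 2
    with hm
  have hφm : ∀ l, IsRegularField Ω β (m l) (φ l) := fun l => (hφ l).mono (by
    simp only [hm]
    gcongr
    exact intervalIntegral.norm_integral_le_integral_norm (mesh_monotone ht.1 (Nat.le_succ l)))
  have hsum : ∑ l ∈ Finset.range N, m l ≤ C * (√T * R) + 1 := by
    simp only [hm, Finset.sum_add_distrib]
    refine add_le_add (sum_mul_integral_mesh_le v hC hR ht hN) ?_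
    rw [Finset.sum_const, Finset.card_range, nsmul_eq_mul, mul_one_div, div_le_one (by positivity)]
    nlinarith
  refine ⟨φ, m, fun l _ => hφm l, fun l hl => ?_, hsum, fun l _ => hφ' l, fun x => ?_⟩
  · rw [add_div]
    refine add_le_add (mul_integral_mesh_le v hC hR ht hN hl) ?_
    refine one_div_le_one_div_of_le (by positivity) ?_
    calc √N ≤ N := by rw [Real.sqrt_le_left (by positivity)]; nlinarith
      _ ≤ (N : ℝ) ^ 2 := by nlinarith
  · have h := norm_eulerMap_sub_le (a := φ) (N := N) (m := m) (e := fun _ => 1 / (N : ℝ) ^ 2)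
      (y := fun l => eulerMap (eulerField ι v t N) l x) (fun l _ => (hφm l).nonneg)
      (fun l _ => (hφm l).norm_map_sub_le) (fun l _ => ?_)
    · refine h.trans ?_
      rw [Finset.sum_const, Finset.card_range, nsmul_eq_mul, div_eq_mul_one_div (Real.exp _)]
      have : (N : ℝ) * (1 / (N : ℝ) ^ 2) = 1 / N := by field_simp
      rw [this]
      gcongr
    · have e : ∀ y : EuclideanSpace ℝ (Fin n), y + eulerField ι v t N l y - y =
        eulerField ι v t N l y := fun y => add_sub_cancel_left _ _
      simp only [eulerMap, e]
      rw [norm_sub_rev]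
      exact hφ' l _

lemma IsRegularFamily.continuous_eulerMap_eulerField (hι : IsRegularFamily Ω β C ι) (N : ℕ) :
    Continuous (eulerMap (eulerField ι v t N) N) :=
  continuous_eulerMap fun _ _ => hι.continuous _

end euler

/-! ### Weak solutions as limits of Euler schemes -/

lemma memLp_comp_test {n : ℕ} {Ω : Set (EuclideanSpace ℝ (Fin n))}
    [IsFiniteMeasure (volume.restrict Ω)] {η : EuclideanSpace ℝ (Fin n) → ℝ} (hη : Continuous η)
    (hc : HasCompactSupport η) {Φ : EuclideanSpace ℝ (Fin n) → EuclideanSpace ℝ (Fin n)}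
    (hΦ : Continuous Φ) : MemLp (fun x => η (Φ x)) 2 (volume.restrict Ω) := by
  obtain ⟨A, hA⟩ := hc.exists_bound_of_continuous hη
  exact MemLp.of_bound (hη.comp hΦ).aestronglyMeasurable A (Eventually.of_forall fun x => hA _)

lemma IsRegularTest.abs_integral_comp_sub_le {n : ℕ} {Ω : Set (EuclideanSpace ℝ (Fin n))}
    [IsFiniteMeasure (volume.restrict Ω)] {β G d : ℝ} {η : EuclideanSpace ℝ (Fin n) → ℝ}
    (hη : IsRegularTest Ω β G η) (h : Lp ℝ 2 (volume.restrict Ω))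
    {Φ Φ' : EuclideanSpace ℝ (Fin n) → EuclideanSpace ℝ (Fin n)} (hΦ : Continuous Φ)
    (hΦ' : Continuous Φ') (hd : ∀ x, ‖Φ x - Φ' x‖ ≤ d) :
    |(∫ x in Ω, h x * η (Φ x)) - ∫ x in Ω, h x * η (Φ' x)| ≤
      ‖h‖ * (rootVolume Ω * (G * d)) := by
  have hG := hη.nonneg
  have hd0 : 0 ≤ d := (norm_nonneg _).trans (hd 0)
  have m1 := memLp_comp_test (Ω := Ω) hη.contDiff.continuous hη.hasCompactSupport hΦ
  have m2 := memLp_comp_test (Ω := Ω) hη.contDiff.continuous hη.hasCompactSupport hΦ'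
  rw [← integral_sub (integrable_Lp_mul h m1) (integrable_Lp_mul h m2)]
  simp only [← mul_sub]
  refine abs_integral_mul_le h (by positivity) (m1.sub m2).aestronglyMeasurable fun x => ?_
  exact (hη.abs_sub_le _ _).trans (by gcongr; exact hd x)

section identification

variable {n : ℕ} {V : Type*} [NormedAddCommGroup V] [NormedSpace ℝ V] [CompleteSpace V]
  {Ω : Set (EuclideanSpace ℝ (Fin n))} {β C T : ℝ}
  {ι : V →ₗ[ℝ] (EuclideanSpace ℝ (Fin n) → EuclideanSpace ℝ (Fin n))}
  {f₀ : Lp ℝ 2 (volume.restrict Ω)} {v : Lp V 2 (volume.restrict (Icc (0 : ℝ) T))}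
  {f : ℝ → Lp ℝ 2 (volume.restrict Ω)} {t : ℝ} {η : EuclideanSpace ℝ (Fin n) → ℝ} {G : ℝ}

/-- A weak solution is the limit of the push-forwards of the initial value by Euler schemes. -/
lemma IsWeakSolution.tendsto_integral_comp_eulerMap [IsFiniteMeasure (volume.restrict Ω)]
    (h : IsWeakSolution T Ω ι f₀ v f) (hT : 0 < T) (hΩo : IsOpen Ω) (hΩ : Convex ℝ Ω)
    (hβ : 0 < β) (hβ1 : β ≤ 1) (hι : IsRegularFamily Ω β C ι) (hη : IsRegularTest Ω β G η)
    (ht : t ∈ Icc 0 T) :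
    Tendsto (fun N => ∫ x in Ω, f₀ x * η (eulerMap (eulerField ι v t N) N x)) atTop
      (𝓝 (∫ x in Ω, f t x * η x)) := by
  have hC := hι.nonneg
  have hG := hη.nonneg
  have hκ := rootVolume_nonneg Ω
  have hinit := h.initial_eq hT hΩo hβ hβ1 hι
  obtain ⟨F, hF⟩ := isCompact_Icc.exists_bound_of_continuousOn h.continuousOn
  have hF0 : 0 ≤ F := (norm_nonneg _).trans (hF t ht)
  set A := C * (√T * ‖v‖) with hA
  have hA0 : 0 ≤ A := by positivity
  have hsq : Tendsto (fun N : ℕ => (A + 1) / √(N : ℝ)) atTop (𝓝 0) :=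
    Tendsto.div_atTop tendsto_const_nhds (Real.tendsto_sqrt_atTop.comp tendsto_natCast_atTop_atTop)
  have hinv : ∀ c : ℝ, Tendsto (fun N : ℕ => c / (N : ℝ)) atTop (𝓝 0) := fun c =>
    Tendsto.div_atTop tendsto_const_nhds tendsto_natCast_atTop_atTop
  have hpow : Tendsto (fun N : ℕ => ((A + 1) / √(N : ℝ)) ^ β) atTop (𝓝 0) := by
    have := hsq.rpow_const (p := β) (Or.inr hβ.le)
    rwa [Real.zero_rpow hβ.ne'] at this
  set X := rootVolume Ω * G * Real.exp (4 * (A + 1)) with hX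
  have hX0 : 0 ≤ X := by positivity
  set B : ℝ → ℕ → ℝ := fun τ N => X * (τ * A + F / N + F * (((A + 1) / √(N : ℝ)) ^ β * (A + 1))) +
    ‖f₀‖ * (rootVolume Ω * (G * (Real.exp (A + 1) / N))) with hB
  have hBlim : ∀ τ, Tendsto (B τ) atTop (𝓝 (X * (τ * A))) := fun τ => by
    have := ((((tendsto_const_nhds (x := τ * A)).add (hinv F)).add
      ((hpow.mul_const (A + 1)).const_mul F)).const_mul X).add
      ((((hinv (Real.exp (A + 1))).const_mul G).const_mul (rootVolume Ω)).const_mul ‖f₀‖)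
    simpa [hB] using this
  -- All terms of `B τ N` except `X * (τ * A)` vanish as `N → ∞`. Here `τ` bounds the oscillation of
  -- `f` on mesh intervals and is arbitrary by uniform continuity; as the modulus of continuity
  -- depends on `f`, this argument gives no uniform rate.
  have main : ∀ τ > 0, ∀ᶠ N in atTop, |(∫ x in Ω, f₀ x * η (eulerMap (eulerField ι v t N) N x)) -
      ∫ x in Ω, f t x * η x| ≤ B τ N := by
    intro τ hτ
    have huc := isCompact_Icc.uniformContinuousOn_of_continuous h.continuousOn
    obtain ⟨δ, hδ, hδf⟩ := Metric.uniformContinuousOn_iff.1 huc τ hτ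
    filter_upwards [(tendsto_order.1 (hinv t)).2 δ hδ,
      (tendsto_order.1 hsq).2 (1 / 2) (by norm_num), eventually_ne_atTop 0] with N h1 h2 hN
    obtain ⟨φ, m, hφ, hmle, hmsum, hφY, hflow⟩ := hι.exists_fields v le_rfl ht hN
    have hmono := mesh_monotone (N := N) ht.1
    have hN0 : (N : ℝ) ≠ 0 := by exact_mod_cast hN
    have key := h.abs_eulerMap_le hT hΩ (δ := 1 / (N : ℝ) ^ 2) (τ := τ) (F := F) hβ hβ1 hι hφ
      (fun l hl => (hmle l hl).trans h2.le) hmono (fun l hl => mesh_mem ht hN hl) hφY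
      (fun l hl s hs => by
        have hs0 := hmono (Nat.le_succ l)
        have hl1 := mesh_mem ht hN (l := l + 1) hl
        have hl0 := mesh_mem ht hN hl.le
        have := hδf s ⟨hl0.1.trans hs.1, hs.2.trans hl1.2⟩ _ hl0 (by
          rw [Real.dist_eq, abs_of_nonneg (by linarith [hs.1])]
          have := mesh_succ_sub (t := t) (N := N) l
          linarith [hs.2])
        rw [dist_eq_norm] at this
        exact this.le) hF hη
    rw [mesh_self hN, mesh_zero, hinit] at key
    have hcf : Continuous (eulerMap φ N) := continuous_eulerMap fun l hl =>
      (hφ l hl).contDiff.continuous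
    have key2 := hη.abs_integral_comp_sub_le f₀ (hι.continuous_eulerMap_eulerField v N (t := t)) hcf
      (fun x => by rw [norm_sub_rev]; exact hflow x)
    have hsumle : ∑ l ∈ Finset.range N, (τ * (C * ∫ s in mesh t N l..mesh t N (l + 1), ‖v s‖) +
        F * (1 / (N : ℝ) ^ 2) + F * (m l ^ β * m l)) ≤
        τ * A + F / N + F * (((A + 1) / √(N : ℝ)) ^ β * (A + 1)) := by
      rw [Finset.sum_add_distrib, Finset.sum_add_distrib]
      gcongr ?_ + ?_ + ?_
      · rw [← Finset.mul_sum]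
        gcongr
        exact sum_mul_integral_mesh_le v hC le_rfl ht hN
      · rw [Finset.sum_const, Finset.card_range, nsmul_eq_mul]
        apply le_of_eq; field_simp
      · rw [← Finset.mul_sum]
        gcongr
        calc _ ≤ ∑ l ∈ Finset.range N, ((A + 1) / √(N : ℝ)) ^ β * m l := by
              refine Finset.sum_le_sum fun l hl => ?_
              have hm0 := (hφ l (Finset.mem_range.1 hl)).nonneg
              have := hmle l (Finset.mem_range.1 hl)
              gcongr
          _ ≤ _ := by rw [← Finset.mul_sum]; gcongr
    have hsum0 : 0 ≤ ∑ l ∈ Finset.range N, (τ * (C * ∫ s in mesh t N l..mesh t N (l + 1), ‖v s‖) +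
        F * (1 / (N : ℝ) ^ 2) + F * (m l ^ β * m l)) := Finset.sum_nonneg fun l hl => by
      have hm0 := (hφ l (Finset.mem_range.1 hl)).nonneg
      have : 0 ≤ ∫ s in mesh t N l..mesh t N (l + 1), ‖v s‖ :=
        intervalIntegral.integral_nonneg (hmono (Nat.le_succ l)) fun _ _ => norm_nonneg _
      positivity
    have key' : |(∫ x in Ω, f t x * η x) - ∫ x in Ω, f₀ x * η (eulerMap φ N x)| ≤
        X * (τ * A + F / N + F * (((A + 1) / √(N : ℝ)) ^ β * (A + 1))) := by
      refine key.trans ?_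
      simp only [hX]
      gcongr
    rw [abs_sub_comm] at key'
    calc _ ≤ _ := abs_sub_le _ (∫ x in Ω, f₀ x * η (eulerMap φ N x)) _
      _ ≤ B τ N := by
        rw [add_comm]
        exact add_le_add key' key2
  rw [Metric.tendsto_nhds]
  intro ε hε
  have hτ : 0 < ε / (X * A + 1) := by positivity
  have hlt : X * (ε / (X * A + 1) * A) < ε := by
    have : X * (ε / (X * A + 1) * A) = ε * (X * A / (X * A + 1)) := by ring
    rw [this]
    refine mul_lt_of_lt_one_right hε ?_
    rw [div_lt_one (by positivity)]
    linarith
  filter_upwards [main _ hτ, (tendsto_order.1 (hBlim _)).2 ε hlt] with N h1 h2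
  rw [Real.dist_eq]
  exact h1.trans_lt h2

/-- The rate of convergence of the Euler schemes depends only on a bound of the velocity. -/
lemma IsWeakSolution.abs_sub_integral_comp_eulerMap_le [IsFiniteMeasure (volume.restrict Ω)]
    (h : IsWeakSolution T Ω ι f₀ v f) (hT : 0 < T) (hΩo : IsOpen Ω) (hΩ : Convex ℝ Ω)
    (hβ : 0 < β) (hβ1 : β ≤ 1) (hι : IsRegularFamily Ω β C ι) (hη : IsRegularTest Ω β G η)
    (ht : t ∈ Icc 0 T) {R : ℝ} (hR : ‖v‖ ≤ R) {N : ℕ} (hN : N ≠ 0) :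
    |(∫ x in Ω, f₀ x * η (eulerMap (eulerField ι v t N) N x)) - ∫ x in Ω, f t x * η x| ≤
      ‖f₀‖ * (rootVolume Ω * (G * (Real.exp (C * (√T * R)) * ((C * (√T * R)) ^ 2 / √N)))) := by
  have hlim := h.tendsto_integral_comp_eulerMap hT hΩo hΩ hβ hβ1 hι hη ht
  -- The scheme with `N` steps is compared with its refinements by `M + 1`, and `M → ∞` turns the
  -- qualitative limit into a bound that does not involve the modulus of continuity of `f`.
  have hmul : Tendsto (fun M : ℕ => N * (M + 1)) atTop atTop :=
    (tendsto_add_atTop_nat 1).const_mul_atTop' (Nat.pos_of_ne_zero hN)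
  refine le_of_tendsto ((tendsto_const_nhds.sub (hlim.comp hmul)).abs)
    (Eventually.of_forall fun M => ?_)
  exact hη.abs_integral_comp_sub_le f₀ (hι.continuous_eulerMap_eulerField v N (t := t))
    (hι.continuous_eulerMap_eulerField v _ (t := t))
    (fun x => hι.norm_eulerMap_sub_refine_le v hR ht hN (Nat.succ_ne_zero M) x)

end identification

/-! ### Passage to the limit under weak convergence of the velocities -/

section weak

variable {V : Type*} [NormedAddCommGroup V] [NormedSpace ℝ V]

/-- Uniform boundedness principle for the sequence regarded in the bidual, where it is pointwise
bounded. -/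
lemma WeaklyTendsto.exists_norm_le {F : Type*} [NormedAddCommGroup F] [NormedSpace ℝ F]
    {u : ℕ → F} {u' : F} (h : WeaklyTendsto u u') : ∃ R, (∀ i, ‖u i‖ ≤ R) ∧ ‖u'‖ ≤ R := by
  obtain ⟨R, hR⟩ := banach_steinhaus
    (g := fun i => NormedSpace.inclusionInDoubleDual ℝ F (u i)) fun l => by
      obtain ⟨c, hc⟩ := (h l).norm.bddAbove_range
      exact ⟨c, fun i => by simpa using hc ⟨i, rfl⟩⟩
  refine ⟨max R ‖u'‖, fun i => le_max_of_le_left ?_, le_max_right _ _⟩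
  have := hR i
  rwa [show ‖NormedSpace.inclusionInDoubleDual ℝ F (u i)‖ = ‖u i‖ from
    (NormedSpace.inclusionInDoubleDualLi ℝ (E := F)).norm_map (u i)] at this

/-- Integration over a subinterval as a continuous linear map on `L²`. -/
noncomputable def intervalIntegralCLM {T a b : ℝ} (ha : 0 ≤ a) (hab : a ≤ b) (hb : b ≤ T) :
    Lp V 2 (volume.restrict (Icc (0 : ℝ) T)) →L[ℝ] V :=
  LinearMap.mkContinuous
    { toFun := fun w => ∫ s in a..b, w s
      map_add' := fun w w' => by
        have hsub : Ioc a b ⊆ Icc 0 T := fun s hs => ⟨ha.trans hs.1.le, hs.2.trans hb⟩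
        simp only [intervalIntegral.integral_of_le hab]
        rw [← integral_add ((integrableOn_Lp_two w).mono_set hsub)
          ((integrableOn_Lp_two w').mono_set hsub)]
        exact integral_congr_ae
          (ae_restrict_of_ae_restrict_of_subset hsub (Lp.coeFn_add w w'))
      map_smul' := fun r w => by
        have hsub : Ioc a b ⊆ Icc 0 T := fun s hs => ⟨ha.trans hs.1.le, hs.2.trans hb⟩
        simp only [intervalIntegral.integral_of_le hab, RingHom.id_apply]
        rw [← integral_smul]
        exact integral_congr_ae
          (ae_restrict_of_ae_restrict_of_subset hsub (Lp.coeFn_smul r w)) }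
    (√(b - a)) fun w => (intervalIntegral.norm_integral_le_integral_norm hab).trans
      (integral_norm_le_sqrt_mul w ha hab hb)

variable {n : ℕ} {Ω : Set (EuclideanSpace ℝ (Fin n))} {β C T : ℝ}
  {ι : V →ₗ[ℝ] (EuclideanSpace ℝ (Fin n) → EuclideanSpace ℝ (Fin n))}
  {v : ℕ → Lp V 2 (volume.restrict (Icc (0 : ℝ) T))}
  {v' : Lp V 2 (volume.restrict (Icc (0 : ℝ) T))} {t : ℝ}

/-- Each coordinate of the value at `x` is a bounded linear functional of the velocity, and in
finite dimension convergence of coordinates is convergence. -/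
lemma IsRegularFamily.tendsto_apply_integral (hι : IsRegularFamily Ω β C ι)
    (hv : WeaklyTendsto v v') {a b : ℝ} (ha : 0 ≤ a) (hab : a ≤ b) (hb : b ≤ T)
    (x : EuclideanSpace ℝ (Fin n)) :
    Tendsto (fun i => ι (∫ s in a..b, v i s) x) atTop (𝓝 (ι (∫ s in a..b, v' s) x)) := by
  refine (EuclideanSpace.equiv (Fin n) ℝ).toHomeomorph.isInducing.tendsto_nhds_iff.2 ?_
  refine tendsto_pi_nhds.2 fun j => ?_
  exact hv ((EuclideanSpace.proj j).comp ((hι.evalCLM x).comp (intervalIntegralCLM ha hab hb)))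

/-- With a fixed number of steps, Euler schemes are continuous for weak convergence. -/
lemma IsRegularFamily.tendsto_eulerMap (hι : IsRegularFamily Ω β C ι)
    (hv : WeaklyTendsto v v') (ht : t ∈ Icc 0 T) {N : ℕ} (hN : N ≠ 0)
    (x : EuclideanSpace ℝ (Fin n)) :
    Tendsto (fun i => eulerMap (eulerField ι (v i) t N) N x) atTop
      (𝓝 (eulerMap (eulerField ι v' t N) N x)) := by
  have hC := hι.nonneg
  obtain ⟨R, hR, -⟩ := hv.exists_norm_le
  set y : ℕ → EuclideanSpace ℝ (Fin n) := fun l => eulerMap (eulerField ι v' t N) l x with hy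
  have hmono := mesh_monotone (N := N) ht.1
  have hb : ∀ i, ‖eulerMap (eulerField ι (v i) t N) N x - eulerMap (eulerField ι v' t N) N x‖ ≤
      Real.exp (C * (√T * R)) * ∑ l ∈ Finset.range N,
        ‖eulerField ι (v i) t N l (y l) - eulerField ι v' t N l (y l)‖ := by
    intro i
    -- The limit polygon `y` is the comparison sequence, so the fields are compared at points that
    -- do not depend on `i`.
    have h := norm_eulerMap_sub_le (a := eulerField ι (v i) t N) (y := y) (N := N)
      (m := fun l => C * ∫ s in mesh t N l..mesh t N (l + 1), ‖v i s‖)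
      (e := fun l => ‖eulerField ι (v i) t N l (y l) - eulerField ι v' t N l (y l)‖)
      (fun l _ => mul_nonneg hC (intervalIntegral.integral_nonneg (hmono (Nat.le_succ l))
        fun _ _ => norm_nonneg _))
      (fun l _ => hι.norm_eulerField_sub_le (v i) ht) (fun l _ => by
        simp only [hy, eulerMap, add_sub_cancel_left, le_refl])
    refine h.trans ?_
    gcongr
    · exact sum_mul_integral_mesh_le (v i) hC (hR i) ht hN
  rw [tendsto_iff_norm_sub_tendsto_zero]
  refine squeeze_zero (fun _ => norm_nonneg _) hb ?_
  have : Tendsto (fun i => ∑ l ∈ Finset.range N,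
      ‖eulerField ι (v i) t N l (y l) - eulerField ι v' t N l (y l)‖) atTop
      (𝓝 (∑ l ∈ Finset.range N, 0)) := by
    refine tendsto_finsetSum _ fun l hl => ?_
    rw [← tendsto_iff_norm_sub_tendsto_zero]
    exact hι.tendsto_apply_integral hv (mesh_mem ht hN (Finset.mem_range.1 hl).le).1
      (hmono (Nat.le_succ l)) ((mesh_mem ht hN (Finset.mem_range.1 hl)).2) (y l)
  simpa using this.const_mul (Real.exp (C * (√T * R)))

/-- Weak convergence of the solutions at a fixed time. -/
lemma tendsto_integral_mul_of_weaklyTendsto [CompleteSpace V] [IsFiniteMeasure (volume.restrict Ω)]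
    {f₀ : Lp ℝ 2 (volume.restrict Ω)} {f : ℕ → ℝ → Lp ℝ 2 (volume.restrict Ω)}
    {f' : ℝ → Lp ℝ 2 (volume.restrict Ω)} (hv : WeaklyTendsto v v')
    (hf : ∀ i, IsWeakSolution T Ω ι f₀ (v i) (f i)) (hf' : IsWeakSolution T Ω ι f₀ v' f')
    (hT : 0 < T) (hΩo : IsOpen Ω) (hΩ : Convex ℝ Ω)
    (hβ : 0 < β) (hβ1 : β ≤ 1) (hι : IsRegularFamily Ω β C ι)
    {η : EuclideanSpace ℝ (Fin n) → ℝ} {G : ℝ} (hη : IsRegularTest Ω β G η) (ht : t ∈ Icc 0 T) :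
    Tendsto (fun i => ∫ x in Ω, f i t x * η x) atTop (𝓝 (∫ x in Ω, f' t x * η x)) := by
  obtain ⟨R, hR, hR'⟩ := hv.exists_norm_le
  set K := ‖f₀‖ * (rootVolume Ω * (G * (Real.exp (C * (√T * R)) * ((C * (√T * R)) ^ 2)))) with hK
  have hb : ∀ N : ℕ, ‖f₀‖ * (rootVolume Ω * (G * (Real.exp (C * (√T * R)) *
      ((C * (√T * R)) ^ 2 / √N)))) = K / √N := fun N => by rw [hK]; ring
  have hlim : Tendsto (fun N : ℕ => K / √(N : ℝ)) atTop (𝓝 0) :=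
    Tendsto.div_atTop tendsto_const_nhds (Real.tendsto_sqrt_atTop.comp tendsto_natCast_atTop_atTop)
  rw [Metric.tendsto_nhds]
  intro ε hε
  -- First `N` is fixed so that the Euler error is below `ε / 3` for all `i` and for the limit; only
  -- then does `i` tend to infinity.
  obtain ⟨N, hNK, hN⟩ :=
    (((tendsto_order.1 hlim).2 (ε / 3) (by positivity)).and (eventually_ne_atTop 0)).exists
  have hfix : Tendsto (fun i => ∫ x in Ω, f₀ x * η (eulerMap (eulerField ι (v i) t N) N x)) atTop
      (𝓝 (∫ x in Ω, f₀ x * η (eulerMap (eulerField ι v' t N) N x))) := by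
    obtain ⟨A, hA⟩ := hη.hasCompactSupport.exists_bound_of_continuous hη.contDiff.continuous
    refine tendsto_integral_of_dominated_convergence (fun x => ‖f₀ x‖ * A) (fun i => ?_) ?_
      (fun i => ?_) ?_
    · exact (Lp.aestronglyMeasurable f₀).mul (hη.contDiff.continuous.comp
        (hι.continuous_eulerMap_eulerField (v i) N (t := t))).aestronglyMeasurable
    · exact ((Lp.memLp f₀).integrable (by norm_num)).norm.mul_const A
    · refine Eventually.of_forall fun x => ?_
      rw [norm_mul]
      exact mul_le_mul_of_nonneg_left (hA _) (norm_nonneg _)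
    · refine Eventually.of_forall fun x => ?_
      exact ((hη.contDiff.continuous.tendsto _).comp
        (hι.tendsto_eulerMap hv ht hN x)).const_mul _
  filter_upwards [Metric.tendsto_nhds.1 hfix (ε / 3) (by positivity)] with i hi
  have h1 := (hf i).abs_sub_integral_comp_eulerMap_le hT hΩo hΩ hβ hβ1 hι hη ht (hR i) hN
  have h2 := hf'.abs_sub_integral_comp_eulerMap_le hT hΩo hΩ hβ hβ1 hι hη ht hR' hN
  rw [hb] at h1 h2
  rw [Real.dist_eq] at hi ⊢
  rw [abs_lt] at hi ⊢
  rw [abs_le] at h1 h2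
  constructor <;> linarith [hi.1, hi.2, h1.1, h1.2, h2.1, h2.2]

end weak

/-! ### Compactness in `L²` at a fixed time -/

/-- Sequential compactness of bounded sets of Hölder functions for pointwise convergence. -/
lemma exists_subseq_tendsto_of_isHolderBounded {n : ℕ} {Ω : Set (EuclideanSpace ℝ (Fin n))}
    {β G : ℝ} (hβ : 0 < β) {u : ℕ → EuclideanSpace ℝ (Fin n) → ℝ}
    (hu : ∀ j, IsHolderBounded Ω β G (u j)) :
    ∃ σ : ℕ → ℕ, StrictMono σ ∧ ∃ k, IsHolderBounded Ω β G k ∧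
      ∀ x ∈ Ω, Tendsto (fun j => u (σ j) x) atTop (𝓝 (k x)) := by
  obtain ⟨D, hDc, hDd⟩ := TopologicalSpace.exists_countable_dense Ω
  have : Countable D := hDc
  -- Tychonoff on a countable dense set replaces the diagonal argument; countability makes the
  -- product sequentially compact. Equicontinuity then propagates convergence to all of `Ω`.
  have hcomp : IsCompact (univ.pi fun _ : D => Icc (-G) G) :=
    isCompact_univ_pi fun _ => isCompact_Icc
  obtain ⟨a, -, σ, hσ, ha⟩ := hcomp.tendsto_subseq (x := fun j (y : D) => u j y.1.1)
    fun j y _ => abs_le.1 ((hu j).abs_le _ y.1.2)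
  rw [tendsto_pi_nhds] at ha
  have hcau : ∀ x ∈ Ω, CauchySeq fun j => u (σ j) x := by
    intro x hx
    rw [Metric.cauchySeq_iff]
    intro ε hε
    have hc : Tendsto (fun r : ℝ => G * r ^ β) (𝓝 0) (𝓝 (G * 0 ^ β)) :=
      ((Real.continuous_rpow_const hβ.le).tendsto 0).const_mul G
    rw [Real.zero_rpow hβ.ne', mul_zero] at hc
    obtain ⟨r, hr, hrG⟩ := Metric.tendsto_nhds_nhds.1 hc (ε / 3) (by positivity)
    obtain ⟨y, hy, hyr⟩ := Metric.dense_iff.1 hDd ⟨x, hx⟩ r hr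
    have hd : ‖x - y.1‖ < r := by
      rw [← dist_eq_norm, dist_comm]; exact hy
    have hG : G * ‖x - y.1‖ ^ β < ε / 3 := by
      have := hrG (x := ‖x - y.1‖) (by simpa using hd)
      rw [Real.dist_eq, sub_zero] at this
      exact (le_abs_self _).trans_lt this
    obtain ⟨J, hJ⟩ := Metric.cauchySeq_iff.1 (ha ⟨y, hyr⟩).cauchySeq (ε / 3) (by positivity)
    refine ⟨J, fun i hi j hj => ?_⟩
    have h1 := hJ i hi j hj
    have h2 := (hu (σ i)).abs_sub_le x hx y.1 y.2
    have h3 := (hu (σ j)).abs_sub_le x hx y.1 y.2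
    rw [Real.dist_eq] at h1 ⊢
    simp only [Function.comp] at h1
    rw [abs_lt] at h1 ⊢
    rw [abs_le] at h2 h3
    constructor <;> linarith [h1.1, h1.2, h2.1, h2.2, h3.1, h3.2]
  have hlim : ∀ x, ∃ c, x ∈ Ω → Tendsto (fun j => u (σ j) x) atTop (𝓝 c) := fun x => by
    by_cases hx : x ∈ Ω
    · obtain ⟨c, hc⟩ := cauchySeq_tendsto_of_complete (hcau x hx)
      exact ⟨c, fun _ => hc⟩
    · exact ⟨0, fun h => (hx h).elim⟩
  choose k hk using hlim
  refine ⟨σ, hσ, k, ⟨fun x hx => ?_, fun x hx y hy => ?_⟩, hk⟩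
  · exact le_of_tendsto (hk x hx).abs (Eventually.of_forall fun j => (hu _).abs_le x hx)
  · exact le_of_tendsto ((hk x hx).sub (hk y hy)).abs
      (Eventually.of_forall fun j => (hu _).abs_sub_le x hx y hy)

section holder

variable {n : ℕ} {Ω : Set (EuclideanSpace ℝ (Fin n))} {β G : ℝ}

lemma IsHolderBounded.aestronglyMeasurable {u : EuclideanSpace ℝ (Fin n) → ℝ}
    (hu : IsHolderBounded Ω β G u) (hβ : 0 < β) (hΩ : MeasurableSet Ω) :
    AEStronglyMeasurable u (volume.restrict Ω) := by
  refine ContinuousOn.aestronglyMeasurable (fun x hx => ?_) hΩ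
  rw [ContinuousWithinAt, tendsto_iff_dist_tendsto_zero]
  have h0 : Tendsto (fun y => G * ‖y - x‖ ^ β) (𝓝[Ω] x) (𝓝 (G * ‖x - x‖ ^ β)) := by
    refine Tendsto.mono_left (Continuous.tendsto ?_ x) nhdsWithin_le_nhds
    exact continuous_const.mul ((Real.continuous_rpow_const hβ.le).comp (by fun_prop))
  rw [sub_self, norm_zero, Real.zero_rpow hβ.ne', mul_zero] at h0
  refine squeeze_zero' (Eventually.of_forall fun _ => dist_nonneg) ?_ h0
  filter_upwards [self_mem_nhdsWithin] with y hy
  exact hu.abs_sub_le y hy x hx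

lemma IsHolderBounded.memLp [IsFiniteMeasure (volume.restrict Ω)]
    {u : EuclideanSpace ℝ (Fin n) → ℝ}
    (hu : IsHolderBounded Ω β G u) (hβ : 0 < β) (hΩ : MeasurableSet Ω) :
    MemLp u 2 (volume.restrict Ω) :=
  MemLp.of_bound (hu.aestronglyMeasurable hβ hΩ) G
    ((ae_restrict_mem hΩ).mono fun x hx => hu.abs_le x hx)

lemma norm_sq_toLp {X : Type*} [MeasurableSpace X] {μ : Measure X} {u : X → ℝ} (h : MemLp u 2 μ) :
    ‖h.toLp u‖ ^ 2 = ∫ x, u x ^ 2 ∂μ := by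
  rw [← real_inner_self_eq_norm_sq, ← integral_mul_eq_inner (h.toLp u) h.coeFn_toLp]
  refine integral_congr_ae ?_
  filter_upwards [h.coeFn_toLp] with x hx
  rw [hx, sq]

/-- Dominated convergence: the squared differences are at most `(2 * G) ^ 2`, which is integrable as
`Ω` has finite measure. -/
lemma tendsto_toLp_of_isHolderBounded [IsFiniteMeasure (volume.restrict Ω)]
    (hβ : 0 < β) (hΩ : MeasurableSet Ω) {u : ℕ → EuclideanSpace ℝ (Fin n) → ℝ}
    {k : EuclideanSpace ℝ (Fin n) → ℝ} (hu : ∀ j, IsHolderBounded Ω β G (u j))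
    (hk : IsHolderBounded Ω β G k) (h : ∀ x ∈ Ω, Tendsto (fun j => u j x) atTop (𝓝 (k x))) :
    Tendsto (fun j => ((hu j).memLp hβ hΩ).toLp (u j)) atTop (𝓝 ((hk.memLp hβ hΩ).toLp k)) := by
  rw [tendsto_iff_norm_sub_tendsto_zero]
  have h2 : Tendsto (fun j => ∫ x in Ω, (u j - k) x ^ 2) atTop (𝓝 (∫ x in Ω, (0 : ℝ))) := by
    refine tendsto_integral_of_dominated_convergence (fun _ => (2 * G) ^ 2) (fun j => ?_)
      (integrable_const _) (fun j => ?_) ?_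
    · exact (((hu j).aestronglyMeasurable hβ hΩ).sub (hk.aestronglyMeasurable hβ hΩ)).pow 2
    · filter_upwards [ae_restrict_mem hΩ] with x hx
      rw [Real.norm_eq_abs, abs_pow]
      have : |(u j - k) x| ≤ 2 * G := (abs_sub _ _).trans (by
        linarith [(hu j).abs_le x hx, hk.abs_le x hx])
      gcongr
    · filter_upwards [ae_restrict_mem hΩ] with x hx
      have := ((h x hx).sub_const (k x)).pow 2
      simpa using this
  have h3 : ∀ j, ‖((hu j).memLp hβ hΩ).toLp (u j) - (hk.memLp hβ hΩ).toLp k‖ =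
      √(∫ x in Ω, (u j - k) x ^ 2) := fun j => by
    rw [← MemLp.toLp_sub, ← norm_sq_toLp, Real.sqrt_sq (norm_nonneg _)]
  simp only [h3]
  have := h2.sqrt
  simpa using this

end holder

section compactness

variable {n : ℕ} {V : Type*} [NormedAddCommGroup V] [NormedSpace ℝ V] [CompleteSpace V]
  {Ω : Set (EuclideanSpace ℝ (Fin n))} {β C T : ℝ}
  {ι : V →ₗ[ℝ] (EuclideanSpace ℝ (Fin n) → EuclideanSpace ℝ (Fin n))}
  {R t : ℝ}

/-- Composition with an Euler scheme is bounded on `L²(Ω)`. -/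
lemma norm_toLp_comp_eulerMap_le [IsFiniteMeasure (volume.restrict Ω)] {c ρ S : ℝ}
    {φ : ℕ → EuclideanSpace ℝ (Fin n) → EuclideanSpace ℝ (Fin n)} {m : ℕ → ℝ}
    {N : ℕ} (h : ∀ l < N, IsRegularField Ω β (m l) (φ l)) (hΩ : MeasurableSet Ω) (hβ : 0 < β)
    (hβ1 : β ≤ 1) (hc : IsDetBound (EuclideanSpace ℝ (Fin n)) c ρ) (hm : ∀ l < N, m l ≤ ρ)
    (hS : ∑ l ∈ Finset.range N, m l ≤ S) {η : EuclideanSpace ℝ (Fin n) → ℝ}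
    (hη : MemLp η 2 (volume.restrict Ω))
    (hη' : MemLp (fun x => η (eulerMap φ N x)) 2 (volume.restrict Ω)) :
    ‖hη'.toLp‖ ≤ √(Real.exp (14 * c * S)) * ‖hη.toLp‖ := by
  have hc1 := hc.one_le
  have hone : IsHolderBounded Ω β 1 (fun _ => 1) :=
    ⟨fun _ _ => by simp, fun x _ y _ => by simp; positivity⟩
  -- The push-forward of Lebesgue measure on `Ω` has a density bounded by the exponential factor; it
  -- is then tested against `η ^ 2`.
  obtain ⟨u', hu', hint⟩ := exists_pushforward_density_eulerMap h hΩ hβ hβ1 hc hm hone zero_le_one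
  have e := hint (fun x => η x ^ 2)
  simp only [one_mul] at e
  have hi : Integrable (fun x => Real.exp (14 * c * S) * η x ^ 2) (volume.restrict Ω) :=
    hη.integrable_sq.const_mul _
  have hb : ‖∫ x in Ω, u' x * η x ^ 2‖ ≤ ∫ x in Ω, Real.exp (14 * c * S) * η x ^ 2 := by
    refine norm_integral_le_of_norm_le hi ?_
    filter_upwards [ae_restrict_mem hΩ] with x hx
    rw [norm_mul, Real.norm_eq_abs, Real.norm_eq_abs, abs_of_nonneg (sq_nonneg (η x))]
    refine mul_le_mul_of_nonneg_right ((hu'.abs_le x hx).trans ?_) (sq_nonneg _)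
    rw [one_mul]
    gcongr
  rw [integral_const_mul, e, ← norm_sq_toLp hη, ← norm_sq_toLp hη'] at hb
  refine abs_le_of_sq_le_sq' (a := ‖hη'.toLp‖) ?_ (by positivity) |>.2
  rw [mul_pow, Real.sq_sqrt (by positivity)]
  exact (le_abs_self _).trans hb

/-- At a fixed time, weak solutions are close in `L²` to bounded sets of Hölder functions. -/
lemma exists_forall_near_isHolderBounded [IsFiniteMeasure (volume.restrict Ω)]
    (hT : 0 < T) (hΩo : IsOpen Ω) (hΩ : Convex ℝ Ω)
    (hβ : 0 < β) (hβ1 : β ≤ 1) (hι : IsRegularFamily Ω β C ι) (ht : t ∈ Icc 0 T)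
    (f₀ : Lp ℝ 2 (volume.restrict Ω)) {ε : ℝ} (hε : 0 < ε) :
    ∃ G, ∀ (v : Lp V 2 (volume.restrict (Icc (0 : ℝ) T))) (f : ℝ → Lp ℝ 2 (volume.restrict Ω)),
      ‖v‖ ≤ R → IsWeakSolution T Ω ι f₀ v f →
      ∃ k, IsHolderBounded Ω β G k ∧ ∃ K : Lp ℝ 2 (volume.restrict Ω),
        K =ᵐ[volume.restrict Ω] k ∧ ‖f t - K‖ ≤ ε := by
  have hC := hι.nonneg
  have hΩm := hΩo.measurableSet
  obtain ⟨c, ρ, hc⟩ := exists_det_one_add_lipschitz (EuclideanSpace ℝ (Fin n))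
  have hc1 := hc.one_le
  have hρ := hc.pos
  set A := C * (√T * R) with hA
  set Q := √(Real.exp (14 * c * (A + 1))) with hQ
  have hQ0 : 0 < Q := by positivity
  -- Here `Q` bounds the norm of composition with the schemes on `L²`, so an error `ε / Q` in the
  -- initial value costs at most `ε` at time `t`. The choice of `g` precedes that of `v` and `f`,
  -- which makes `G` uniform.
  obtain ⟨g₀, hg₀, hg₀f⟩ := Metric.dense_iff.1 (Lp.dense_hasCompactSupport_contDiff (F := ℝ)
    (μ := volume.restrict Ω) (p := 2) (by norm_num)) f₀ (ε / Q) (by positivity)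
  obtain ⟨g, hgg, hgc, hgs⟩ := hg₀f
  rw [Metric.mem_ball, dist_comm, dist_eq_norm] at hg₀
  obtain ⟨G₀, hG₀, hgH⟩ := exists_isHolderBounded Ω hβ hβ1 hgs hgc
  refine ⟨G₀ * Real.exp (14 * c * (A + 1)), fun v f hv hf => ?_⟩
  have hsq : Tendsto (fun N : ℕ => (A + 1) / √(N : ℝ)) atTop (𝓝 0) :=
    Tendsto.div_atTop tendsto_const_nhds (Real.tendsto_sqrt_atTop.comp tendsto_natCast_atTop_atTop)
  obtain ⟨N₀, hN₀⟩ := eventually_atTop.1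
    (((tendsto_order.1 hsq).2 ρ hρ).and (eventually_ne_atTop 0))
  have hN : ∀ j, N₀ + j ≠ 0 := fun j => (hN₀ _ (Nat.le_add_right _ _)).2
  choose φ m hφ hmle hmsum _ hflow using fun j => hι.exists_fields v hv ht (hN j)
  have hmρ : ∀ j, ∀ l < N₀ + j, m j l ≤ ρ := fun j l hl =>
    (hmle j l hl).trans (hN₀ _ (Nat.le_add_right _ _)).1.le
  choose u hu hint using fun j => exists_pushforward_density_eulerMap (hφ j) hΩm hβ hβ1 hc
    (hmρ j) hgH hG₀
  have hu' : ∀ j, IsHolderBounded Ω β (G₀ * Real.exp (14 * c * (A + 1))) (u j) := fun j => by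
    have hle : G₀ * Real.exp (14 * c * ∑ l ∈ Finset.range (N₀ + j), m j l) ≤
        G₀ * Real.exp (14 * c * (A + 1)) := by
      gcongr
      exact hmsum j
    exact ⟨fun x hx => ((hu j).abs_le x hx).trans hle, fun x hx y hy =>
      ((hu j).abs_sub_le x hx y hy).trans (by gcongr)⟩
  -- The Hölder bounds of the push-forwards of `g` do not depend on the number of steps, so a limit
  -- density `k` exists with the same bounds.
  obtain ⟨σ, hσ, k, hk, hlim⟩ := exists_subseq_tendsto_of_isHolderBounded hβ hu'
  have hkm := hk.memLp hβ hΩm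
  refine ⟨k, hk, hkm.toLp k, hkm.coeFn_toLp, ?_⟩
  refine Lp.norm_le_of_forall_test hΩo _ hε.le fun ψ gψ h1 h2 h3 h4 => ?_
  obtain ⟨B, hB⟩ := exists_isRegularTest hβ hβ1 h1 h2 h3
  have hψm : MemLp ψ 2 (volume.restrict Ω) := (h1.continuous.memLp_of_hasCompactSupport h2).restrict Ω
  have hψg : hψm.toLp = gψ := Lp.ext (hψm.coeFn_toLp.trans h4.symm)
  have hNlim : Tendsto (fun j => N₀ + σ j) atTop atTop :=
    tendsto_atTop_mono (fun j => Nat.le_add_left _ _) hσ.tendsto_atTop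
  have la := (hf.tendsto_integral_comp_eulerMap hT hΩo hΩ hβ hβ1 hι hB ht).comp hNlim
  have lb : Tendsto (fun j => ∫ x in Ω, u (σ j) x * ψ x) atTop
      (𝓝 (inner ℝ gψ (hkm.toLp k))) := by
    refine (tendsto_const_nhds.inner (tendsto_toLp_of_isHolderBounded hβ hΩm
      (fun j => hu' (σ j)) hk hlim)).congr fun j => ?_
    rw [← integral_mul_eq_inner _ h4]
    refine integral_congr_ae ?_
    filter_upwards [((hu' (σ j)).memLp hβ hΩm).coeFn_toLp] with x hx
    rw [hx]
  have hinv : Tendsto (fun j => ‖f₀‖ * (rootVolume Ω * (B * (Real.exp (A + 1) /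
      ((N₀ + σ j : ℕ) : ℝ)))) + ε * ‖gψ‖) atTop
      (𝓝 (‖f₀‖ * (rootVolume Ω * (B * 0)) + ε * ‖gψ‖)) :=
    ((((Tendsto.div_atTop tendsto_const_nhds
      (tendsto_natCast_atTop_atTop.comp hNlim)).const_mul _).const_mul _).const_mul _).add_const _
  rw [integral_mul_eq_inner _ h4, inner_sub_right, ← integral_mul_eq_inner (f t) h4]
  rw [mul_zero, mul_zero, mul_zero, zero_add] at hinv
  refine le_of_tendsto_of_tendsto ((la.sub lb).abs) hinv (Eventually.of_forall fun j => ?_)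
  have hcf : Continuous (eulerMap (φ (σ j)) (N₀ + σ j)) := continuous_eulerMap fun l hl =>
    (hφ (σ j) l hl).contDiff.continuous
  have hψc := memLp_comp_test (Ω := Ω) h1.continuous h2 hcf
  have d1 := hB.abs_integral_comp_sub_le f₀
    (hι.continuous_eulerMap_eulerField v (N₀ + σ j) (t := t)) hcf
    (fun x => by rw [norm_sub_rev]; exact hflow (σ j) x)
  -- Both integrals are pairings with the same pulled-back function `ψ`, of `f₀` and of `g₀`
  -- respectively.
  have d2 : |(∫ x in Ω, f₀ x * ψ (eulerMap (φ (σ j)) (N₀ + σ j) x)) -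
      ∫ x in Ω, u (σ j) x * ψ x| ≤ ε * ‖gψ‖ := by
    have e : ∫ x in Ω, u (σ j) x * ψ x =
        ∫ x in Ω, g₀ x * ψ (eulerMap (φ (σ j)) (N₀ + σ j) x) := by
      rw [hint]
      refine integral_congr_ae ?_
      filter_upwards [hgg] with x hx
      rw [hx]
    rw [e, integral_mul_eq_inner _ hψc.coeFn_toLp, integral_mul_eq_inner _ hψc.coeFn_toLp,
      ← inner_sub_right]
    have b1 := norm_toLp_comp_eulerMap_le (hφ (σ j)) hΩm hβ hβ1 hc (hmρ (σ j)) (hmsum (σ j))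
      hψm hψc
    rw [hψg] at b1
    calc _ ≤ ‖hψc.toLp‖ * ‖f₀ - g₀‖ := abs_real_inner_le_norm _ _
      _ ≤ (Q * ‖gψ‖) * (ε / Q) := by gcongr
      _ = ε * ‖gψ‖ := by field_simp
  exact (abs_sub_le _ _ _).trans (add_le_add d1 d2)

end compactness

/-! ### Conclusion -/

/-- Stability of weak solutions of the continuity equation under weak convergence of the
velocity fields. -/
theorem mainTheorem5 {n : ℕ} (Ω : Set (EuclideanSpace ℝ (Fin n)))
    (hΩ_open : IsOpen Ω) (hΩ_bdd : Bornology.IsBounded Ω) (hΩ_conv : Convex ℝ Ω)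
    (T : ℝ) (hT : 0 < T) (α : ℝ≥0) (hα : 0 < α)
    {V : Type*} [NormedAddCommGroup V] [NormedSpace ℝ V] [CompleteSpace V]
    (ι : V →ₗ[ℝ] (EuclideanSpace ℝ (Fin n) → EuclideanSpace ℝ (Fin n)))
    (hι : IsC1HolderZeroEmbedding Ω α ι)
    (f₀ : Lp ℝ 2 (volume.restrict Ω))
    (v : ℕ → Lp V 2 (volume.restrict (Icc (0 : ℝ) T)))
    (v' : Lp V 2 (volume.restrict (Icc (0 : ℝ) T)))
    (hv : WeaklyTendsto v v')
    (f : ℕ → ℝ → Lp ℝ 2 (volume.restrict Ω)) (f' : ℝ → Lp ℝ 2 (volume.restrict Ω))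
    (hf : ∀ i, IsWeakSolution T Ω ι f₀ (v i) (f i))
    (hf' : IsWeakSolution T Ω ι f₀ v' f')
    (t : ℝ) (ht : t ∈ Icc 0 T) :
    ∃ σ : ℕ → ℕ, StrictMono σ ∧ Tendsto (fun k => f (σ k) t) atTop (𝓝 (f' t)) := by
  obtain ⟨β, hβ, hβ1, C, hC, happ⟩ := hι.exists_approx hΩ_open hΩ_bdd hα
  have hfam : IsRegularFamily Ω β C ι := ⟨hC, happ⟩
  have hfin : IsFiniteMeasure (volume.restrict Ω) :=
    isFiniteMeasure_restrict.2 hΩ_bdd.measure_lt_top.ne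
  have hΩm := hΩ_open.measurableSet
  obtain ⟨R, hR, -⟩ := hv.exists_norm_le
  -- The whole sequence converges, so no extraction is needed.
  refine ⟨id, strictMono_id, ?_⟩
  rw [Metric.tendsto_nhds]
  intro ε' hε'
  set ε := ε' / 3 with hεdef
  have hε : 0 < ε := by positivity
  -- Otherwise some subsequence stays at distance at least `ε'` from `f' t`; a further subsequence
  -- of its Hölder approximations converges in `L²`.
  by_contra hcon
  obtain ⟨σ, hσ, hσε⟩ := extraction_of_frequently_atTop (not_eventually.1 hcon)
  obtain ⟨G, hG⟩ := exists_forall_near_isHolderBounded hT hΩ_open hΩ_conv hβ hβ1 hfam ht f₀ hε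
  choose k hk K hKk hKf using fun i => hG (v i) (f i) (hR i) (hf i)
  obtain ⟨τ, hτ, k', hk', hlim⟩ :=
    exists_subseq_tendsto_of_isHolderBounded hβ fun j => hk (σ j)
  have hKlim := tendsto_toLp_of_isHolderBounded hβ hΩm (fun j => hk (σ (τ j))) hk' hlim
  have hKeq : ∀ i, ((hk i).memLp hβ hΩm).toLp (k i) = K i := fun i =>
    Lp.ext (((hk i).memLp hβ hΩm).coeFn_toLp.trans (hKk i).symm)
  simp only [hKeq] at hKlim
  set K' := (hk'.memLp hβ hΩm).toLp k' with hK'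
  -- The differences `f i t - K i` have norm at most `ε` and, along the subsequence, converge weakly
  -- to `f' t - K'`; the norm is weakly lower semicontinuous.
  have hdist : ‖f' t - K'‖ ≤ ε := by
    refine Lp.norm_le_of_forall_test hΩ_open _ hε.le fun ψ g h1 h2 h3 h4 => ?_
    obtain ⟨B, hB⟩ := exists_isRegularTest hβ hβ1 h1 h2 h3
    have l1 := tendsto_integral_mul_of_weaklyTendsto hv hf hf' hT hΩ_open hΩ_conv hβ hβ1 hfam hB ht
    simp only [integral_mul_eq_inner _ h4] at l1 ⊢
    rw [inner_sub_right]
    refine le_of_tendsto ((l1.comp (hσ.comp hτ).tendsto_atTop).sub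
      (tendsto_const_nhds.inner hKlim)).abs (Eventually.of_forall fun j => ?_)
    simp only [Function.comp, ← inner_sub_right]
    refine (abs_real_inner_le_norm _ _).trans ?_
    rw [mul_comm]
    exact mul_le_mul_of_nonneg_right (hKf _) (norm_nonneg _)
  -- One index suffices: the three distances between `f i t`, `K i`, `K'` and `f' t` add up to less
  -- than `3 * ε = ε'`.
  obtain ⟨j, hj⟩ := (Metric.tendsto_nhds.1 hKlim ε hε).exists
  refine hσε (τ j) ?_
  rw [dist_eq_norm] at hj ⊢
  have e : f (id (σ (τ j))) t - f' t =
      (f (σ (τ j)) t - K (σ (τ j))) + (K (σ (τ j)) - K') - (f' t - K') := by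
    simp only [id]; abel
  rw [e]
  have a1 := norm_sub_le ((f (σ (τ j)) t - K (σ (τ j))) + (K (σ (τ j)) - K')) (f' t - K')
  have a2 := norm_add_le (f (σ (τ j)) t - K (σ (τ j))) (K (σ (τ j)) - K')
  have a3 := hKf (σ (τ j))
  linarith
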